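/- Let $W:\mathcal X\to\mathcal Z$ be a discrete memoryless channel with finite non-empty input alphabet $\mathcal X$ and finite output alphabet $\mathcal Z$, with output distributions $W_x$ ($x\in\mathcal X$). Assume that $W$ is non-redundant: for no $y\in\mathcal X$ and no probability distribution $P$ on $\mathcal X$ with $P(y)=0$ is $W_y=\sum_x P(x)W_x$. All logarithms are to base $2$. A commitment protocol with $n$ uses of $W$ consists of a finite non-empty set $\mathcal A$ of messages, independent discrete random variables $M$ (Alice) and $N$ (Bob), a number $r$ of rounds of noiseless two-way communication, times $0\le r_1\le\dots\le r_n\le r$, deterministic functions for the commit phase, and a test. In round $j$ Alice, who commits to $a\in\mathcal A$, sends $U_j=f_j(a,M,V^{j-1})$, and Bob answers $V_j=g_j(Z^{i},N,U^{j})$, where $i$ is the number of indices $k$ with $r_k<j$. Between the rounds $r_i$ and $r_i+1$ Alice sends $X_i=F_i(a,M,V^{r_i})$ through $W$ and Bob receives the output $Z_i$. To reveal, Alice announces $a$ and $M$, and Bob applies his test $\beta(Z^n,N,U^r;a,M)\in\{\mathrm{ACC},\mathrm{REJ}\}$. The protocol is $\epsilon$-concealing if, whatever strategy (with whatever private discrete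 random variable, again called $N$) Bob uses in the commit phase, while Alice is honest, the distributions of $(Z^n,N,U^r)$ for any two messages $a,a'$ have total variation distance at most $\epsilon$. It is $\delta$-binding if (1) for honest parties and every $a\in\mathcal A$, $\Pr\{\beta(Z^n,N,U^r;a,M)=\mathrm{ACC}\}\ge 1-\delta$; and (2) for every strategy of Alice in the commit phase, based on a discrete random variable $S$ independent of $N$, while Bob is honest, and for all functions $A,A',\widetilde M,\widetilde M'$ of $(S,V^r)$ with $A\ne A'$ with probability $1$, $$\Pr\{\beta(Z^n,N,U^r;A,\widetilde M)=\mathrm{ACC}\ \text{and}\ \beta(Z^n,N,U^r;A',\widetilde M')=\mathrm{ACC}\}\le\delta .$$ Let $B\in[0,\infty]$. A rate $R$ is achievable if for every $n$ there is a protocol with $n$ uses of $W$ in which $U^r$ takes at most $2^{Bn}$ values (no restriction if $B=\infty$), which is $\epsilon_n$-concealing and $\delta_n$-binding, such that $\epsilon_n,\delta_n\to0$ and $\frac1n\log|\mathcal A_n|\to R$ as $n\to\infty$. The commitment capacity $C_{\rm com}(W)$ is the supremum of all achievable rates. Theorem. For every $B\in[0,\infty]$, $$C_{\rm com}(W)=\max\{H(X|Z):\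 X,Z\text{ random variables with }\operatorname{Distr}(Z|X)=W\},$$ the maximal equivocation of the channel over all input distributions (the maximum is attained). In particular the value is the same whether or not the noiseless communication from Alice is restricted by a constant $B$. -/

import Mathlib

open scoped ENNReal NNReal Topology

noncomputable section

namespace Commitment

/-! ### Channels and entropies (all logarithms are to base 2) -/

/-- A discrete channel `W : X → PMF Z` is non-redundant if no output distribution is a convex
combination of the other ones. -/
def NonRedundant {X Z : Type*} (W : X → PMF Z) : Prop :=
  ∀ (y : X) (P : PMF X), P y = 0 → W y ≠ P.bind W

/-- Shannon entropy in bits. -/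
def entropy {α : Type*} [Fintype α] (p : PMF α) : ℝ :=
  - ∑ a, (p a).toReal * Real.logb 2 (p a).toReal

/-- The joint law of input and output when the input of `W` is distributed according to `P`. -/
def jointLaw {X Z : Type*} (W : X → PMF Z) (P : PMF X) : PMF (X × Z) :=
  P.bind fun x => (W x).map fun z => (x, z)

/-- The equivocation `H(X|Z) = H(XZ) - H(Z)` of the channel for the input distribution `P`. -/
def equivocation {X Z : Type*} [Fintype X] [Fintype Z] (W : X → PMF Z) (P : PMF X) : ℝ :=
  entropy (jointLaw W P) - entropy ((jointLaw W P).map Prod.snd)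

/-- Total variation distance `½‖p - q‖₁` of two discrete distributions. -/
def tvDist {α : Type*} (p q : PMF α) : ℝ :=
  (1 / 2) * ∑' a, |(p a).toReal - (q a).toReal|

/-- The probability of an event. -/
def prob {α : Type*} (p : PMF α) (E : α → Prop) : ℝ :=
  (p.toOuterMeasure {a | E a}).toReal

/-! ### The commit phase -/

/-- When things happen in the commit phase: there are `r` rounds of noiseless communication, and
the `i`-th use of the noisy channel (`i = 0, 1, …`) takes place after round `slot i` and before
the next round; `slot i = 0` means before the first round. -/
structure Schedule where
  r : ℕ
  slot : ℕ → ℕ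
  slot_mono : Monotone slot
  slot_le : ∀ i, slot i ≤ r

/-- If the channel is used `n` times in total, this is the number of channel uses that precede
the round with number `j + 1`. -/
def Schedule.usesBefore (T : Schedule) (n j : ℕ) : ℕ :=
  Nat.count (fun i => T.slot i < j + 1) n

/-- A behaviour of Alice in the commit phase, with private data in `S`: `send s v` is her next
noiseless message after she has received the messages `v` from Bob (the number of the round is
`v.length + 1`), and `input s i v` is her input to the `i`-th use of the noisy channel. -/
structure AliceStrategy (S U V X : Type*) where
  send : S → List V → U
  input : S → ℕ → List V → X

/-- A behaviour of Bob in the commit phase, with private data in `N`: `reply ν z u` is his next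
noiseless message when he has received the channel outputs `z` and the messages `u`, the last
entry of `u` being Alice's message of the current round. -/
structure BobStrategy (N U V Z : Type*) where
  reply : N → List Z → List U → V

/-- The noiseless messages `(U^j, V^j)` of the first `j` rounds if the outputs of the
noisy channel are `z`. Bob's reply in a round uses only the outputs he has got before it. -/
def messages {S N U V X Z : Type*} (T : Schedule) (n : ℕ) (al : AliceStrategy S U V X)
    (bo : BobStrategy N U V Z) (s : S) (ν : N) (z : List Z) : ℕ → List U × List V
  | 0 => ([], [])
  | j + 1 =>
    let h := messages T n al bo s ν z j
    let u := h.1 ++ [al.send s h.2]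
    (u, h.2 ++ [bo.reply ν (z.take (T.usesBefore n j)) u])

/-- The law of the outputs of `n` uses of the memoryless channel `W` when the `i`-th input is the
function `x i` of the previous outputs. -/
def outputLaw {X Z : Type*} (W : X → PMF Z) (x : (i : ℕ) → (Fin i → Z) → X) :
    (n : ℕ) → PMF (Fin n → Z)
  | 0 => PMF.pure Fin.elim0
  | n + 1 => (outputLaw W x n).bind fun z =>
      (W (x n z)).map fun y => (Fin.snoc z y : Fin (n + 1) → Z)

/-- Everything that is present after the commit phase: Alice's private data, Bob's private data,
the outputs `Z^n` of the noisy channel and the noiseless messages `U^r` and `V^r`. -/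
structure Outcome (S N U V Z : Type*) (n : ℕ) where
  alice : S
  bob : N
  z : Fin n → Z
  u : List U
  v : List V

/-- The law of the outcome of a commit phase with `n` uses of `W`, where the private data of
Alice and of Bob are independent with laws `pS` and `pN`. -/
def commitLaw {S N U V X Z : Type*} (W : X → PMF Z) (n : ℕ) (T : Schedule)
    (pS : PMF S) (al : AliceStrategy S U V X) (pN : PMF N) (bo : BobStrategy N U V Z) :
    PMF (Outcome S N U V Z n) :=
  pS.bind fun s => pN.bind fun ν =>
    (outputLaw W (fun i z => al.input s i
        (messages T n al bo s ν (List.ofFn z) (T.slot i)).2) n).map fun z =>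
      let h := messages T n al bo s ν (List.ofFn z) T.r
      { alice := s, bob := ν, z := z, u := h.1, v := h.2 }

/-! ### Commitment protocols -/

/-- A commitment protocol with `n` uses of a noisy channel from `X` to `Z`: the finite set `Msg`
of messages, the private random variables `M` of Alice and `N` of Bob, the schedule of the commit
phase with the strategies of the honest parties (for Alice depending on the message she commits
to), and Bob's test `test z ν u a μ` in the reveal phase, in which Alice announces her message `a`
and the value `μ` of her random variable. -/
structure Protocol (X Z : Type*) (n : ℕ) where
  Msg : Type
  msg_finite : Finite Msg
  msg_nonempty : Nonempty Msg
  M : Type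
  N : Type
  U : Type
  V : Type
  pM : PMF M
  pN : PMF N
  sched : Schedule
  alice : Msg → AliceStrategy M U V X
  bob : BobStrategy N U V Z
  test : (Fin n → Z) → N → List U → Msg → M → Prop

namespace Protocol

variable {X Z : Type*} {n : ℕ}

/-- The range of `U^r`: all sequences of noiseless messages that Alice, following the protocol,
may have to send, for any message, any value of `M` and any replies of Bob. -/
def sentRange (p : Protocol X Z n) : Set (List p.U) :=
  {u | ∃ (a : p.Msg) (μ : p.M) (v : List p.V), v.length = p.sched.r ∧
    u = (List.range p.sched.r).map fun j => (p.alice a).send μ (v.take j)}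

/-- The range of `U^r` has at most `2 ^ (B n)` elements; no condition if `B = ∞`. -/
def SentBounded (p : Protocol X Z n) (B : ℝ≥0∞) : Prop :=
  B ≠ ∞ → p.sentRange.Finite ∧ (p.sentRange.ncard : ℝ) ≤ (2 : ℝ) ^ (B.toReal * n)

/-- The law of Bob's view `(Z^n, N, U^r)` if Alice honestly commits to `a`, while Bob uses the
strategy `bo` with a private random variable of law `q`. -/
def viewLaw (p : Protocol X Z n) (W : X → PMF Z) (a : p.Msg) {N' : Type} (q : PMF N')
    (bo : BobStrategy N' p.U p.V Z) : PMF ((Fin n → Z) × N' × List p.U) :=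
  (commitLaw W n p.sched p.pM (p.alice a) q bo).map fun c => (c.z, c.bob, c.u)

/-- The protocol is `ε`-concealing: whatever Bob does in the commit phase, his views for
any two messages are `ε`-close. -/
def Concealing (p : Protocol X Z n) (W : X → PMF Z) (ε : ℝ) : Prop :=
  ∀ (N' : Type) (q : PMF N') (bo : BobStrategy N' p.U p.V Z) (a a' : p.Msg),
    tvDist (p.viewLaw W a q bo) (p.viewLaw W a' q bo) ≤ ε

/-- If both parties follow the protocol, then Bob accepts with probability at least `1 - δ`. -/
def Sound (p : Protocol X Z n) (W : X → PMF Z) (δ : ℝ) : Prop :=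
  ∀ a : p.Msg, 1 - δ ≤ prob (commitLaw W n p.sched p.pM (p.alice a) p.pN p.bob)
    fun c => p.test c.z c.bob c.u a c.alice

/-- Whatever Alice does in the commit phase, using a random variable `S`, and however she then
computes two claims `(A, μ)`, `(A', μ')` from `S` and Bob's messages such that `A ≠ A'` almost
surely, Bob would accept both of them with probability at most `δ`. -/
def NoDoubleOpening (p : Protocol X Z n) (W : X → PMF Z) (δ : ℝ) : Prop :=
  ∀ (S : Type) (pS : PMF S) (al : AliceStrategy S p.U p.V X)
    (A A' : S → List p.V → p.Msg) (μ μ' : S → List p.V → p.M),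
    prob (commitLaw W n p.sched pS al p.pN p.bob)
      (fun c => A c.alice c.v ≠ A' c.alice c.v) = 1 →
    prob (commitLaw W n p.sched pS al p.pN p.bob)
      (fun c => p.test c.z c.bob c.u (A c.alice c.v) (μ c.alice c.v) ∧
        p.test c.z c.bob c.u (A' c.alice c.v) (μ' c.alice c.v)) ≤ δ

/-- `δ`-sound and `δ`-binding. -/
def Binding (p : Protocol X Z n) (W : X → PMF Z) (δ : ℝ) : Prop :=
  p.Sound W δ ∧ p.NoDoubleOpening W δ

/-- The rate `(1/n) log |Msg|`. -/
def rate (p : Protocol X Z n) : ℝ :=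
  Real.logb 2 (Nat.card p.Msg) / n

end Protocol

/-- The rate `R` is achievable for `W`, with noiseless messages of Alice bounded by `B`. -/
def Achievable {X Z : Type*} (W : X → PMF Z) (B : ℝ≥0∞) (R : ℝ) : Prop :=
  ∃ (p : (n : ℕ) → Protocol X Z n) (ε δ : ℕ → ℝ),
    (∀ n, (p n).SentBounded B ∧ (p n).Concealing W (ε n) ∧ (p n).Binding W (δ n)) ∧
    Filter.Tendsto (fun n => (p n).rate) Filter.atTop (𝓝 R) ∧
    Filter.Tendsto ε Filter.atTop (𝓝 0) ∧ Filter.Tendsto δ Filter.atTop (𝓝 0)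

/-- `C` is the commitment capacity of `W`, i.e. the supremum of all achievable rates. -/
def IsCommitmentCapacity {X Z : Type*} (W : X → PMF Z) (B : ℝ≥0∞) (C : ℝ) : Prop :=
  IsLUB {R : ℝ | Achievable W B R} C

end Commitment

end

noncomputable section

namespace Commitment

/-! ### Product distributions -/

section Product

variable {ι α : Type*} [Fintype ι] [DecidableEq ι] [Fintype α]

/-! Achievability needs no noiseless communication. Fix an input law `P` and a rate below its
equivocation. Take the words whose outputs are mostly typical, and thin them out to a set with
linear pairwise Hamming distance; since small balls contain only `2 ^ (γ n)` words, this costs an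
arbitrarily small exponent. Distribute these words at random over about `2 ^ (n R)` bins, one for
each message. Alice sends a random word of the bin of her message. A second-moment computation shows
that most bins induce nearly the same output law (`exists_binning`, `exists_bins`), which gives
concealment. For binding, non-redundancy yields, for each letter, a function on `Z` with mean `0`
under that letter and mean at least `1` under all others (`NonRedundant.exists_separating`). Summed
along a word, it is a test of whether the outputs fit. Whatever word is really sent, it is far from
one of any two words in different bins, and Chebyshev's inequality makes the test reject that one.

For the converse, let the message be uniform and Alice honest. Given the channel inputs and the
noiseless messages, the private data of Alice are independent of what Bob holds, so the transcript
alone suffices to compute an opening that Bob accepts as often as the honest one (`exists_decoder`).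
Unless this opening names the true message, Alice could open twice; hence the transcript determines
the message with error at most `3 * δ`. Bob's view contains the whole transcript except for the
inputs. Weighing the input words by the product of the backward probabilities gives a score of each
message, computable from the view, with total at most `1`. By Markov's inequality the score of the
true message is at least `2 ^ (-t)`, `t = n (C + γ)`, with probability bounded away from `0`. By
concealment the view may be replaced by that for one fixed message, and for any view at most `2 ^ t`
messages reach this score; this bounds the number of messages (`Protocol.card_bound`).

Both halves together give the same value for every `B`: the codes send no noiseless message, and the
converse covers any amount of noiseless communication. -/

theorem sum_prod_eq_prod_sum (p : ι → α → ℝ) :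
    ∑ F : ι → α, ∏ i, p i (F i) = ∏ i, ∑ a, p i a := by
  rw [Finset.prod_univ_sum, Fintype.piFinset_univ]

theorem sum_prod_eq_one {p : ι → α → ℝ} (hp : ∀ i, ∑ a, p i a = 1) :
    ∑ F : ι → α, ∏ i, p i (F i) = 1 := by
  rw [sum_prod_eq_prod_sum]
  exact Finset.prod_eq_one fun i _ => hp i

theorem sum_prod_mul_single {p : ι → α → ℝ} (hp : ∀ i, ∑ a, p i a = 1) (i : ι) (h : α → ℝ) :
    ∑ F : ι → α, (∏ k, p k (F k)) * h (F i) = ∑ a, p i a * h a := by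
  have h1 : ∀ F : ι → α, (∏ k, p k (F k)) * h (F i)
      = ∏ k, (p k (F k) * if k = i then h (F k) else 1) := by
    intro F
    rw [Finset.prod_mul_distrib, Finset.prod_ite_eq' Finset.univ i]
    simp
  simp_rw [h1]
  rw [sum_prod_eq_prod_sum (fun k a => p k a * if k = i then h a else 1),
    Finset.prod_eq_single i]
  · simp
  · intro k _ hk
    simp [hk, hp]
  · simp

theorem sum_prod_mul_pair {p : ι → α → ℝ} (hp : ∀ i, ∑ a, p i a = 1) {i j : ι} (hij : i ≠ j)
    (g h : α → ℝ) :
    ∑ F : ι → α, (∏ k, p k (F k)) * (g (F i) * h (F j))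
      = (∑ a, p i a * g a) * ∑ a, p j a * h a := by
  have h1 : ∀ F : ι → α, (∏ k, p k (F k)) * (g (F i) * h (F j))
      = ∏ k, (p k (F k) * ((if k = i then g (F k) else 1) * if k = j then h (F k) else 1)) := by
    intro F
    rw [Finset.prod_mul_distrib, Finset.prod_mul_distrib, Finset.prod_ite_eq' Finset.univ i,
      Finset.prod_ite_eq' Finset.univ j]
    simp
  simp_rw [h1]
  rw [sum_prod_eq_prod_sum
    (fun k a => p k a * ((if k = i then g a else 1) * if k = j then h a else 1)),
    Finset.prod_eq_mul i j hij]
  · simp [hij, hij.symm]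
  · intro k _ hk
    simp [hk.1, hk.2, hp]
  · simp
  · simp

/-- The second moment of a sum of independent centred random variables. -/
theorem sum_prod_mul_sq {p g : ι → α → ℝ} (hp : ∀ i, ∑ a, p i a = 1)
    (hg : ∀ i, ∑ a, p i a * g i a = 0) :
    ∑ F : ι → α, (∏ k, p k (F k)) * (∑ i, g i (F i)) ^ 2 = ∑ i, ∑ a, p i a * g i a ^ 2 := by
  have h1 : ∀ F : ι → α, (∏ k, p k (F k)) * (∑ i, g i (F i)) ^ 2
      = ∑ i, ∑ j, (∏ k, p k (F k)) * (g i (F i) * g j (F j)) := by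
    intro F
    rw [sq, Finset.sum_mul_sum, Finset.mul_sum]
    exact Finset.sum_congr rfl fun i _ => Finset.mul_sum _ _ _
  simp_rw [h1]
  rw [Finset.sum_comm]
  refine Finset.sum_congr rfl fun i _ => ?_
  rw [Finset.sum_comm, Finset.sum_eq_single i]
  · rw [← sum_prod_mul_single hp i (fun a => g i a ^ 2)]
    exact Finset.sum_congr rfl fun F _ => by rw [sq]
  · intro j _ hj
    rw [sum_prod_mul_pair hp hj.symm, hg, zero_mul]
  · simp

/-- Chebyshev's inequality for sums of independent random variables with values in `[-b, b]`:
deviations of size `t` on an event `E`. -/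
theorem sum_prod_le_of_deviation {p g : ι → α → ℝ} {b t : ℝ} (hp0 : ∀ i a, 0 ≤ p i a)
    (hp : ∀ i, ∑ a, p i a = 1) (hb : ∀ i a, |g i a| ≤ b) (ht : 0 < t) (E : (ι → α) → Prop)
    [DecidablePred E]
    (hE : ∀ F, E F → t ≤ |∑ i, g i (F i) - ∑ i, ∑ a, p i a * g i a|) :
    ∑ F : ι → α, (if E F then ∏ k, p k (F k) else 0) ≤ Fintype.card ι * b ^ 2 / t ^ 2 := by
  set m : ι → ℝ := fun i => ∑ a, p i a * g i a with hm
  have h0 : ∀ i, ∑ a, p i a * (g i a - m i) = 0 := by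
    intro i
    simp_rw [mul_sub, Finset.sum_sub_distrib, ← Finset.sum_mul, hp]
    simp [hm]
  have h2 := sum_prod_mul_sq (p := p) (g := fun i a => g i a - m i) hp h0
  have h3 : ∀ i, ∑ a, p i a * (g i a - m i) ^ 2 ≤ b ^ 2 := by
    intro i
    have e1 : ∑ a, p i a * (g i a - m i) ^ 2 = ∑ a, p i a * g i a ^ 2 - m i ^ 2 := by
      have : ∀ a, p i a * (g i a - m i) ^ 2
          = p i a * g i a ^ 2 - 2 * m i * (p i a * g i a) + m i ^ 2 * p i a := by
        intro a; ring
      simp_rw [this, Finset.sum_add_distrib, Finset.sum_sub_distrib, ← Finset.mul_sum, hp]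
      simp only [hm]; ring
    have e2 : ∑ a, p i a * g i a ^ 2 ≤ ∑ a, p i a * b ^ 2 := by
      refine Finset.sum_le_sum fun a _ => mul_le_mul_of_nonneg_left ?_ (hp0 i a)
      exact sq_le_sq' (abs_le.1 (hb i a)).1 (abs_le.1 (hb i a)).2
    rw [← Finset.sum_mul, hp, one_mul] at e2
    nlinarith [sq_nonneg (m i)]
  rw [le_div_iff₀ (by positivity), Finset.sum_mul]
  calc ∑ F : ι → α, (if E F then ∏ k, p k (F k) else 0) * t ^ 2
      ≤ ∑ F : ι → α, (∏ k, p k (F k)) * (∑ i, (g i (F i) - m i)) ^ 2 := by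
        refine Finset.sum_le_sum fun F _ => ?_
        have hpos : 0 ≤ ∏ k, p k (F k) := Finset.prod_nonneg fun k _ => hp0 k _
        split_ifs with h
        · refine mul_le_mul_of_nonneg_left ?_ hpos
          have := hE F h
          rw [Finset.sum_sub_distrib, ← sq_abs (_ - _)]
          exact pow_le_pow_left₀ ht.le this 2
        · rw [zero_mul]; positivity
    _ = ∑ i, ∑ a, p i a * (g i a - m i) ^ 2 := h2
    _ ≤ ∑ _i : ι, b ^ 2 := Finset.sum_le_sum fun i _ => h3 i
    _ = Fintype.card ι * b ^ 2 := by simp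

end Product

/-! ### Non-redundancy and separating functionals -/

section PMFReal

variable {α : Type*} [Fintype α]

theorem sum_toReal_pmf (p : PMF α) : ∑ a, (p a).toReal = 1 := by
  rw [← ENNReal.toReal_sum fun a _ => p.apply_ne_top a, ← tsum_fintype (L := .unconditional _),
    p.tsum_coe, ENNReal.toReal_one]

/-- The distribution with given real weights. -/
def pmfOfReal (w : α → ℝ) (h0 : ∀ a, 0 ≤ w a) (h1 : ∑ a, w a = 1) : PMF α :=
  PMF.ofFintype (fun a => ENNReal.ofReal (w a)) (by
    rw [← ENNReal.ofReal_sum_of_nonneg fun a _ => h0 a, h1, ENNReal.ofReal_one])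

theorem pmfOfReal_toReal (w : α → ℝ) (h0 : ∀ a, 0 ≤ w a) (h1 : ∑ a, w a = 1) (a : α) :
    (pmfOfReal w h0 h1 a).toReal = w a := by
  simp [pmfOfReal, h0 a]

theorem bind_toReal {β : Type*} (p : PMF α) (f : α → PMF β) (b : β) :
    (p.bind f b).toReal = ∑ a, (p a).toReal * (f a b).toReal := by
  rw [PMF.bind_apply, tsum_fintype, ENNReal.toReal_sum]
  · exact Finset.sum_congr rfl fun a _ => ENNReal.toReal_mul
  · exact fun a _ => ENNReal.mul_ne_top (p.apply_ne_top a) ((f a).apply_ne_top b)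

end PMFReal

/-- Every output distribution of a non-redundant channel is separated from the other ones by a
function on the output alphabet. -/
theorem NonRedundant.exists_separating {X Z : Type*} [Fintype X] [Fintype Z] {W : X → PMF Z}
    (hW : NonRedundant W) :
    ∃ f : X → Z → ℝ, ∀ y, ∑ z, (W y z).toReal * f y z = 0 ∧
      ∀ x, x ≠ y → 1 ≤ ∑ z, (W x z).toReal * f y z := by
  classical
  suffices h : ∀ y, ∃ f : Z → ℝ, ∑ z, (W y z).toReal * f z = 0 ∧
      ∀ x, x ≠ y → 1 ≤ ∑ z, (W x z).toReal * f z from ⟨fun y => (h y).choose,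
        fun y => (h y).choose_spec⟩
  intro y
  let w : X → Z → ℝ := fun x z => (W x z).toReal
  -- This is non-redundancy: the weights of a convex combination, extended by `0` at `y`, form an
  -- input law `P` with `P y = 0`.
  have hy : w y ∉ convexHull ℝ (w '' {x | x ≠ y}) := by
    intro hmem
    have : ∃ c : X → ℝ, (∀ x, 0 ≤ c x) ∧ ∑ x, c x = 1 ∧ c y = 0 ∧ ∑ x, c x • w x = w y := by
      rw [Set.image_eq_range, convexHull_range_eq_exists_affineCombination] at hmem
      obtain ⟨s, c, hc0, hc1, hc⟩ := hmem
      rw [Finset.affineCombination_eq_linear_combination _ _ _ hc1] at hc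
      refine ⟨fun x => if h : x ≠ y then (if (⟨x, h⟩ : {x | x ≠ y}) ∈ s then c ⟨x, h⟩ else 0)
        else 0, ?_, ?_, by simp, ?_⟩
      · intro x
        dsimp only
        split_ifs with h1 h2
        · exact hc0 _ h2
        · exact le_rfl
        · exact le_rfl
      · rw [← hc1]
        symm
        refine Finset.sum_bij_ne_zero (fun i _ _ => (i : X)) (by simp) ?_ ?_ ?_
        · intro a _ _ b _ _ h
          exact Subtype.ext h
        · intro x _ hx
          split_ifs at hx with h1 h2
          · exact ⟨⟨x, h1⟩, h2, hx, rfl⟩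
          · exact absurd rfl hx
          · exact absurd rfl hx
        · intro a ha _
          have h1 : (a : X) ≠ y := a.2
          simp [h1, ha]
      · rw [← hc]
        symm
        refine Finset.sum_bij_ne_zero (fun i _ _ => (i : X)) (by simp) ?_ ?_ ?_
        · intro a _ _ b _ _ h
          exact Subtype.ext h
        · intro x _ hx
          dsimp only at hx
          split_ifs at hx with h1 h2
          · exact ⟨⟨x, h1⟩, h2, hx, rfl⟩
          · simp at hx
          · simp at hx
        · intro a ha _
          have h1 : (a : X) ≠ y := a.2
          simp [h1, ha]
    obtain ⟨c, hc0, hc1, hcy, hc⟩ := this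
    refine hW y (pmfOfReal c hc0 hc1) ?_ ?_
    · simp [pmfOfReal, hcy]
    · ext z
      rw [← ENNReal.toReal_eq_toReal_iff' (PMF.apply_ne_top _ _) (PMF.apply_ne_top _ _),
        bind_toReal]
      simp_rw [pmfOfReal_toReal]
      have := congrFun hc z
      simp only [Finset.sum_apply, Pi.smul_apply, smul_eq_mul, w] at this
      exact this.symm
  have hfin : (w '' {x | x ≠ y}).Finite := Set.toFinite _
  obtain ⟨φ, u, hu1, hu2⟩ := geometric_hahn_banach_point_closed (convex_convexHull ℝ _)
    (hfin.isClosed_convexHull ℝ) hy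
  have hφ : ∀ v : Z → ℝ, φ v = ∑ z, v z * φ (Pi.single z 1) := by
    intro v
    conv_lhs => rw [pi_eq_sum_univ' v, map_sum]
    refine Finset.sum_congr rfl fun z _ => ?_
    rw [map_smul, smul_eq_mul]
  have hd : 0 < u - φ (w y) := by linarith
  have key : ∀ x, ∑ z, (W x z).toReal * ((φ (Pi.single z 1) - φ (w y)) / (u - φ (w y)))
      = (φ (w x) - φ (w y)) / (u - φ (w y)) := by
    intro x
    simp_rw [← mul_div_assoc, ← Finset.sum_div, mul_sub, Finset.sum_sub_distrib, ← Finset.sum_mul,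
      sum_toReal_pmf, one_mul]
    rw [hφ (w x)]
  -- Output laws have total mass `1`, so subtracting a constant from the functional shifts all its
  -- means equally. The affine normalisation takes the value at `w y` to `0` and the separating
  -- level `u` to `1`.
  refine ⟨fun z => (φ (Pi.single z 1) - φ (w y)) / (u - φ (w y)), ?_, ?_⟩
  · rw [key]; simp
  · intro x hx
    rw [key, le_div_iff₀ hd]
    have := hu2 (w x) (subset_convexHull ℝ _ ⟨x, hx, rfl⟩)
    linarith

/-! ### Probabilities -/

section Prob

variable {α β : Type*}

theorem toOuterMeasure_le_one (p : PMF α) (s : Set α) : p.toOuterMeasure s ≤ 1 := by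
  rw [PMF.toOuterMeasure_apply, ← p.tsum_coe]
  exact ENNReal.tsum_le_tsum fun a => Set.indicator_le_self' (fun _ _ => zero_le) a

theorem prob_le_one (p : PMF α) (E : α → Prop) : prob p E ≤ 1 :=
  ENNReal.toReal_le_of_le_ofReal zero_le_one (by simpa using toOuterMeasure_le_one p _)

theorem prob_mono (p : PMF α) {E F : α → Prop} (h : ∀ a, E a → F a) : prob p E ≤ prob p F :=
  ENNReal.toReal_mono (ne_top_of_le_ne_top ENNReal.one_ne_top (toOuterMeasure_le_one p _))
    (p.toOuterMeasure.mono h)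

theorem prob_map (p : PMF α) (f : α → β) (E : β → Prop) :
    prob (p.map f) E = prob p fun a => E (f a) := by
  rw [prob, PMF.toOuterMeasure_map_apply]
  rfl

theorem prob_eq_one_iff (p : PMF α) (E : α → Prop) :
    prob p E = 1 ↔ ∀ a, p a ≠ 0 → E a := by
  rw [prob, ENNReal.toReal_eq_one_iff, PMF.toOuterMeasure_apply_eq_one_iff]
  rfl

theorem prob_fintype [Fintype α] (p : PMF α) (E : α → Prop) [DecidablePred E] :
    prob p E = ∑ a, if E a then (p a).toReal else 0 := by
  rw [prob, PMF.toOuterMeasure_apply_fintype, ENNReal.toReal_sum]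
  · refine Finset.sum_congr rfl fun a _ => ?_
    by_cases h : E a <;> simp [Set.indicator, h]
  · intro a _
    exact ne_top_of_le_ne_top (p.apply_ne_top a) (Set.indicator_le_self' (fun _ _ => zero_le) a)

theorem prob_bind_le (p : PMF α) (f : α → PMF β) (E : β → Prop) {c : ℝ} (hc : 0 ≤ c)
    (h : ∀ a, p a ≠ 0 → prob (f a) E ≤ c) : prob (p.bind f) E ≤ c := by
  refine ENNReal.toReal_le_of_le_ofReal hc ?_
  rw [PMF.toOuterMeasure_bind_apply]
  calc ∑' a, p a * (f a).toOuterMeasure {b | E b}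
      ≤ ∑' a, p a * ENNReal.ofReal c := by
        refine ENNReal.tsum_le_tsum fun a => ?_
        by_cases ha : p a = 0
        · simp [ha]
        · gcongr
          rw [← ENNReal.ofReal_toReal (ne_top_of_le_ne_top ENNReal.one_ne_top
            (toOuterMeasure_le_one (f a) {b | E b}))]
          exact ENNReal.ofReal_le_ofReal (h a ha)
    _ = ENNReal.ofReal c := by rw [ENNReal.tsum_mul_right, p.tsum_coe, one_mul]

theorem prob_not (p : PMF α) (E : α → Prop) : prob p (fun a => ¬ E a) = 1 - prob p E := by
  classical
  have h : p.toOuterMeasure {a | ¬ E a} + p.toOuterMeasure {a | E a} = 1 := by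
    rw [PMF.toOuterMeasure_apply, PMF.toOuterMeasure_apply, ← ENNReal.tsum_add, ← p.tsum_coe]
    refine tsum_congr fun a => ?_
    by_cases h : E a <;> simp [Set.indicator, h]
  have h2 := congrArg ENNReal.toReal h
  rw [ENNReal.toReal_add (ne_top_of_le_ne_top ENNReal.one_ne_top (toOuterMeasure_le_one p _))
    (ne_top_of_le_ne_top ENNReal.one_ne_top (toOuterMeasure_le_one p _)), ENNReal.toReal_one] at h2
  rw [prob, prob]
  linarith

/-- Data processing: whatever Bob adds to the channel outputs cannot help him to distinguish
messages. -/
theorem tvDist_bind_le [Fintype α] (p q : PMF α) (f : α → PMF β) :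
    tvDist (p.bind f) (q.bind f) ≤ tvDist p q := by
  have hsum : ∀ a, Summable fun b => (f a b).toReal := fun a =>
    ENNReal.summable_toReal (f a).tsum_coe_ne_top
  have hone : ∀ a, ∑' b, (f a b).toReal = 1 := fun a => by
    rw [← ENNReal.tsum_toReal_eq fun b => (f a).apply_ne_top b, (f a).tsum_coe, ENNReal.toReal_one]
  unfold tvDist
  refine mul_le_mul_of_nonneg_left ?_ (by norm_num)
  have hs : Summable fun b => ∑ a, |(p a).toReal - (q a).toReal| * (f a b).toReal :=
    summable_sum fun a _ => (hsum a).mul_left _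
  have hle : ∀ b, |(p.bind f b).toReal - (q.bind f b).toReal|
      ≤ ∑ a, |(p a).toReal - (q a).toReal| * (f a b).toReal := by
    intro b
    rw [bind_toReal, bind_toReal, ← Finset.sum_sub_distrib]
    refine (Finset.abs_sum_le_sum_abs _ _).trans (Finset.sum_le_sum fun a _ => ?_)
    rw [← sub_mul, abs_mul, abs_of_nonneg (ENNReal.toReal_nonneg (a := f a b))]
  calc ∑' b, |(p.bind f b).toReal - (q.bind f b).toReal|
      ≤ ∑' b, ∑ a, |(p a).toReal - (q a).toReal| * (f a b).toReal :=
        Summable.tsum_le_tsum hle (Summable.of_nonneg_of_le (fun b => abs_nonneg _) hle hs) hs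
    _ = ∑ a, ∑' b, |(p a).toReal - (q a).toReal| * (f a b).toReal :=
        Summable.tsum_finsetSum fun a _ => (hsum a).mul_left _
    _ = ∑' a, |(p a).toReal - (q a).toReal| := by
        rw [tsum_fintype]
        refine Finset.sum_congr rfl fun a _ => ?_
        rw [tsum_mul_left, hone, mul_one]

/-- Finitely many distributions are the marginals of a product distribution. -/
theorem exists_pmf_pi {ι B : Type*} [Fintype ι] [DecidableEq ι] [Fintype B] (q : ι → PMF B) :
    ∃ p : PMF (ι → B), ∀ i, p.map (fun F => F i) = q i := by
  classical
  refine ⟨pmfOfReal (fun F => ∏ i, (q i (F i)).toReal)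
    (fun F => Finset.prod_nonneg fun _ _ => ENNReal.toReal_nonneg)
    (sum_prod_eq_one (p := fun i b => (q i b).toReal) fun i => sum_toReal_pmf (q i)),
    fun i => ?_⟩
  ext b
  rw [← ENNReal.toReal_eq_toReal_iff' (PMF.apply_ne_top _ _) (PMF.apply_ne_top _ _),
    PMF.map, bind_toReal]
  simp_rw [pmfOfReal_toReal]
  have := sum_prod_mul_single (p := fun i b => (q i b).toReal) (fun i => sum_toReal_pmf (q i)) i
    (fun c => ((PMF.pure c : PMF B) b).toReal)
  simp only [Function.comp_apply]
  rw [this]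
  simp [PMF.pure_apply, apply_ite ENNReal.toReal]

end Prob

/-! ### The outputs of the channel -/

section Output

variable {X Z : Type*}

theorem outputLaw_apply (W : X → PMF Z) (x : (i : ℕ) → (Fin i → Z) → X) (n : ℕ) (z : Fin n → Z) :
    outputLaw W x n z
      = ∏ i : Fin n, W (x i fun k : Fin i => z (Fin.castLE i.isLt.le k)) (z i) := by
  classical
  induction n with
  | zero =>
    have : z = Fin.elim0 := Subsingleton.elim _ _
    simp [outputLaw, this]
  | succ n ih =>
    rw [outputLaw, PMF.bind_apply, tsum_eq_single (Fin.init z)]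
    · rw [PMF.map_apply, tsum_eq_single (z (Fin.last n)), ih, Fin.prod_univ_castSucc]
      · simp [Fin.snoc_init_self]
        rfl
      · intro y hy
        rw [if_neg]
        intro h
        apply hy
        rw [h, Fin.snoc_last]
    · intro z' hz'
      rw [mul_eq_zero]
      right
      rw [PMF.map_apply, ENNReal.tsum_eq_zero]
      intro y
      rw [if_neg]
      intro h
      apply hz'
      rw [h, Fin.init_snoc]

/-- The law of the outputs when the word `x` is sent. -/
def wordLaw [Fintype Z] (W : X → PMF Z) {n : ℕ} (x : Fin n → X) : PMF (Fin n → Z) :=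
  pmfOfReal (fun z => ∏ i, (W (x i) (z i)).toReal)
    (fun _ => Finset.prod_nonneg fun _ _ => ENNReal.toReal_nonneg)
    (sum_prod_eq_one (p := fun i z => (W (x i) z).toReal) fun i => sum_toReal_pmf (W (x i)))

theorem wordLaw_toReal [Fintype Z] (W : X → PMF Z) {n : ℕ} (x : Fin n → X) (z : Fin n → Z) :
    (wordLaw W x z).toReal = ∏ i, (W (x i) (z i)).toReal :=
  pmfOfReal_toReal _ _ _ _

theorem outputLaw_const [Fintype Z] (W : X → PMF Z) (x : ℕ → X) (n : ℕ) :
    outputLaw W (fun i _ => x i) n = wordLaw W fun i : Fin n => x i := by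
  ext z
  rw [← ENNReal.toReal_eq_toReal_iff' (PMF.apply_ne_top _ _) (PMF.apply_ne_top _ _),
    wordLaw_toReal, outputLaw_apply, ENNReal.toReal_prod]

end Output

/-! ### Protocols from codes -/

section Code

/-- With no rounds every slot is `0` and there is no feedback, so the channel receives a word fixed
by Alice's data. -/
theorem commitLaw_of_silent {S N U V X Z : Type*} [Fintype Z] (W : X → PMF Z) {n : ℕ}
    {T : Schedule} (hT : T.r = 0) (pS : PMF S) (al : AliceStrategy S U V X)
    (pN : PMF N) (bo : BobStrategy N U V Z) :
    commitLaw W n T pS al pN bo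
      = pS.bind fun s => pN.bind fun ν =>
        (wordLaw W fun i : Fin n => al.input s i []).map fun z => ⟨s, ν, z, [], []⟩ := by
  unfold commitLaw
  congr 1
  funext s
  congr 1
  funext ν
  rw [← outputLaw_const W (fun i => al.input s i [])]
  have h : ∀ i, T.slot i = 0 := fun i => Nat.le_zero.1 (hT ▸ T.slot_le i)
  simp only [h, hT, messages]

variable {X Z : Type*} [Fintype Z]

/-- The protocol without noiseless communication in which Alice commits to `a` by sending a random
word with index distributed according to `q a`. Bob checks that the index belongs to `a` and that
the word fits to the outputs. -/
abbrev codeProtocol [Nonempty X] {n : ℕ} {A B : Type} [Fintype A] [DecidableEq A] [Nonempty A]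
    [Fintype B] (q : A → PMF B) (c : B → Fin n → X) (acc : (Fin n → X) → (Fin n → Z) → Prop) :
    Protocol X Z n where
  Msg := A
  msg_finite := inferInstance
  msg_nonempty := inferInstance
  -- The law of `M` must not depend on the message, so Alice draws an index for every message at
  -- once; the coordinate at `a` has law `q a`.
  M := A → B
  N := Unit
  U := Unit
  V := Unit
  pM := (exists_pmf_pi q).choose
  pN := PMF.pure ()
  sched := ⟨0, fun _ => 0, fun _ _ _ => le_rfl, fun _ => le_rfl⟩
  -- Strategies are defined for all `i : ℕ`; the arbitrary letter for `i ≥ n` is never sent.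
  alice a := ⟨fun _ _ => (), fun μ i _ =>
    if h : i < n then c (μ a) ⟨i, h⟩ else Classical.arbitrary X⟩
  bob := ⟨fun _ _ _ => ()⟩
  -- Without the support condition Alice could open any message with the word that she really sent.
  test z _ _ a μ := μ a ∈ (q a).support ∧ acc (c (μ a)) z

variable [Nonempty X] {n : ℕ} {A B : Type} [Fintype A] [DecidableEq A] [Nonempty A]
  [Fintype B] (W : X → PMF Z) (q : A → PMF B) (c : B → Fin n → X)
  (acc : (Fin n → X) → (Fin n → Z) → Prop)

theorem codeProtocol_viewLaw (a : A) {N : Type} (r : PMF N) (bo : BobStrategy N Unit Unit Z) :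
    (codeProtocol q c acc).viewLaw W a r bo
      = ((q a).bind fun b => wordLaw W (c b)).bind fun z => r.map fun ν => (z, ν, []) := by
  unfold Protocol.viewLaw
  rw [commitLaw_of_silent W rfl, ← (exists_pmf_pi q).choose_spec a, PMF.bind_map, PMF.map_bind,
    PMF.bind_bind]
  refine congrArg _ (funext fun μ => ?_)
  have h1 : (wordLaw W fun i : Fin n => ((codeProtocol (Z := Z) q c acc).alice a).input μ i [])
      = wordLaw W (c (μ a)) := by
    congr 1
    funext i
    simp
  rw [PMF.map_bind, h1]
  simp only [PMF.map, PMF.bind_bind, PMF.pure_bind, Function.comp_apply]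
  rw [PMF.bind_comm]
  rfl

/-- The protocol of a code is concealing and binding if different messages have nearly the same
output laws, the test accepts words which have been sent, and words for different messages are
never both accepted with large probability. -/
theorem codeProtocol_spec {ε δ : ℝ} (hδ : 0 ≤ δ)
    (hε : ∀ a a', tvDist ((q a).bind fun b => wordLaw W (c b))
      ((q a').bind fun b => wordLaw W (c b)) ≤ ε)
    (hsound : ∀ b, prob (wordLaw W (c b)) (fun z => ¬ acc (c b) z) ≤ δ)
    (hbind : ∀ a a' b b', a ≠ a' → b ∈ (q a).support → b' ∈ (q a').support →
      ∀ x : Fin n → X, prob (wordLaw W x) (fun z => acc (c b) z ∧ acc (c b') z) ≤ δ) :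
    (∀ B, (codeProtocol (Z := Z) q c acc).SentBounded B) ∧
    (codeProtocol q c acc).Concealing W ε ∧ (codeProtocol q c acc).Binding W δ := by
  refine ⟨?_, ?_, ?_, ?_⟩
  · intro B _
    have hsub : (codeProtocol (Z := Z) q c acc).sentRange ⊆ {[]} := by
      rintro u ⟨a, μ, v, -, hu⟩
      rw [hu]
      rfl
    refine ⟨(Set.finite_singleton _).subset hsub, ?_⟩
    have h1 := Set.ncard_le_ncard hsub (Set.finite_singleton _)
    rw [Set.ncard_singleton] at h1
    calc ((codeProtocol (Z := Z) q c acc).sentRange.ncard : ℝ) ≤ 1 := by exact_mod_cast h1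
      _ ≤ (2 : ℝ) ^ (B.toReal * n) :=
        Real.one_le_rpow one_le_two (mul_nonneg ENNReal.toReal_nonneg (Nat.cast_nonneg _))
  · intro N' r bo a a'
    refine le_trans ?_ (hε a a')
    have h := fun a => codeProtocol_viewLaw W q c acc a r bo
    exact (congrArg₂ tvDist (h a) (h a')).le.trans (tvDist_bind_le _ _ _)
  · intro a
    have hle : prob (commitLaw W n (codeProtocol (Z := Z) q c acc).sched
        (codeProtocol (Z := Z) q c acc).pM ((codeProtocol (Z := Z) q c acc).alice a)
        (codeProtocol (Z := Z) q c acc).pN (codeProtocol (Z := Z) q c acc).bob)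
        (fun o => ¬ (codeProtocol q c acc).test o.z o.bob o.u a o.alice) ≤ δ := by
      rw [commitLaw_of_silent W rfl]
      refine prob_bind_le _ _ _ hδ fun μ hμ => prob_bind_le _ _ _ hδ fun ν _ => ?_
      rw [prob_map]
      have h1 : (wordLaw W fun i : Fin n =>
          ((codeProtocol (Z := Z) q c acc).alice a).input μ i []) = wordLaw W (c (μ a)) := by
        congr 1
        funext i
        simp
      refine (congrArg (fun p => prob p _) h1).le.trans ((prob_mono _ fun z hz hacc => ?_).trans
        (hsound (μ a)))
      refine hz ⟨?_, hacc⟩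
      rw [← (exists_pmf_pi q).choose_spec a, PMF.mem_support_map_iff]
      exact ⟨μ, hμ, rfl⟩
    rw [prob_not] at hle
    linarith
  · intro S pS al D D' μ μ' hne
    rw [prob_eq_one_iff] at hne
    rw [commitLaw_of_silent W rfl] at hne ⊢
    refine prob_bind_le _ _ _ hδ fun s hs => prob_bind_le _ _ _ hδ fun ν hν => ?_
    rw [prob_map]
    -- Bob's messages are always empty, so the two claims depend on `s` only, and any output in the
    -- support shows that they differ.
    have hD : D s [] ≠ D' s [] := by
      obtain ⟨z, hz⟩ := (wordLaw W fun i : Fin n => al.input s i []).support_nonempty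
      refine hne ⟨s, ν, z, [], []⟩ ?_
      rw [← PMF.mem_support_iff, PMF.mem_support_bind_iff]
      refine ⟨s, hs, ?_⟩
      rw [PMF.mem_support_bind_iff]
      refine ⟨ν, hν, ?_⟩
      rw [PMF.mem_support_map_iff]
      exact ⟨z, hz, rfl⟩
    by_cases hb : μ s [] (D s []) ∈ (q (D s [])).support ∧
        μ' s [] (D' s []) ∈ (q (D' s [])).support
    · exact (prob_mono _ fun z hz => ⟨hz.1.2, hz.2.2⟩).trans (hbind _ _ _ _ hD hb.1 hb.2 _)
    · refine le_trans (le_of_eq ?_) hδ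
      rw [prob, ENNReal.toReal_eq_zero_iff]
      left
      have : {z : Fin n → Z | (codeProtocol q c acc).test z ν [] (D s []) (μ s []) ∧
          (codeProtocol q c acc).test z ν [] (D' s []) (μ' s [])} = ∅ :=
        Set.eq_empty_of_forall_notMem fun z hz => hb ⟨hz.1.1, hz.2.1⟩
      exact (congrArg _ this).trans (MeasureTheory.measure_empty (μ := PMF.toOuterMeasure _))

end Code

/-! ### Packings -/

/-- A bound for the number of words in a Hamming ball. -/
theorem card_hammingBall_le {X : Type*} [Fintype X] [DecidableEq X] {n : ℕ} (x : Fin n → X)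
    {s : ℝ} (hs0 : 0 < s) (hs1 : s ≤ 1) (r : ℝ) :
    ((Finset.univ.filter fun y : Fin n → X => (hammingDist x y : ℝ) < r).card : ℝ) * s ^ r
      ≤ (1 + Fintype.card X * s) ^ n := by
  -- Exponential weights as in a Chernoff bound: `s ^ hammingDist x y` factorises over the
  -- coordinates, and it is at least `s ^ r` on the ball.
  have h1 : ∀ y : Fin n → X, s ^ hammingDist x y = ∏ i, if x i = y i then 1 else s := by
    intro y
    rw [Finset.prod_ite, Finset.prod_const_one, one_mul, Finset.prod_const]
    rfl
  have h2 : ∑ y : Fin n → X, s ^ hammingDist x y ≤ (1 + Fintype.card X * s) ^ n := by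
    simp_rw [h1]
    rw [sum_prod_eq_prod_sum fun i b => if x i = b then 1 else s]
    calc ∏ i, ∑ b, (if x i = b then (1 : ℝ) else s)
        ≤ ∏ _i : Fin n, (1 + Fintype.card X * s) := by
          refine Finset.prod_le_prod (fun i _ => Finset.sum_nonneg fun b _ => ?_) fun i _ => ?_
          · split_ifs <;> positivity
          · calc ∑ b, (if x i = b then (1 : ℝ) else s)
                ≤ ∑ b, ((if x i = b then (1 : ℝ) else 0) + s) := by
                  refine Finset.sum_le_sum fun b _ => ?_
                  split_ifs <;> linarith
              _ = 1 + Fintype.card X * s := by simp [Finset.sum_add_distrib]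
      _ = (1 + Fintype.card X * s) ^ n := by simp
  refine le_trans ?_ h2
  rw [← nsmul_eq_mul, ← Finset.sum_const]
  calc ∑ y ∈ Finset.univ.filter (fun y : Fin n → X => (hammingDist x y : ℝ) < r), s ^ r
      ≤ ∑ y ∈ Finset.univ.filter (fun y : Fin n → X => (hammingDist x y : ℝ) < r),
          s ^ hammingDist x y := by
        refine Finset.sum_le_sum fun y hy => ?_
        rw [← Real.rpow_natCast]
        exact Real.rpow_le_rpow_of_exponent_ge hs0 hs1 (Finset.mem_filter.1 hy).2.le
    _ ≤ ∑ y : Fin n → X, s ^ hammingDist x y :=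
        Finset.sum_le_sum_of_subset_of_nonneg (Finset.subset_univ _) fun _ _ _ => by positivity

/-- A weighted Gilbert–Varshamov bound. -/
theorem exists_packing {α : Type*} [DecidableEq α] [Fintype α] (near : α → α → Prop)
    [∀ x y, Decidable (near x y)] (hrefl : ∀ x, near x x) (hsymm : ∀ x y, near x y → near y x)
    (wt : α → ℝ) (hwt : ∀ x, 0 ≤ wt x) {N : ℝ}
    (hN : ∀ x, ((Finset.univ.filter fun y => near x y).card : ℝ) ≤ N) (T : Finset α) :
    ∃ C ⊆ T, (∀ x ∈ C, ∀ y ∈ C, x ≠ y → ¬ near x y) ∧ ∑ x ∈ T, wt x ≤ N * ∑ x ∈ C, wt x := by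
  induction T using Finset.strongInduction with
  | H T ih =>
    rcases T.eq_empty_or_nonempty with rfl | hT
    · exact ⟨∅, le_rfl, by simp, by simp⟩
    -- Greedy choice: keep a heaviest point and discard everything near it; what is discarded weighs
    -- at most `N * wt x`.
    obtain ⟨x, hxT, hx⟩ := T.exists_max_image wt hT
    have hss : T.filter (fun y => ¬ near x y) ⊂ T :=
      Finset.filter_ssubset.2 ⟨x, hxT, not_not.2 (hrefl x)⟩
    obtain ⟨C, hCT, hC, hw⟩ := ih _ hss
    have hxC : x ∉ C := fun h => (Finset.mem_filter.1 (hCT h)).2 (hrefl x)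
    refine ⟨insert x C, ?_, ?_, ?_⟩
    · exact Finset.insert_subset hxT (hCT.trans (Finset.filter_subset _ _))
    · intro a ha b hb hab
      rcases Finset.mem_insert.1 ha with rfl | ha' <;>
        rcases Finset.mem_insert.1 hb with rfl | hb'
      · exact absurd rfl hab
      · exact (Finset.mem_filter.1 (hCT hb')).2
      · exact fun h => (Finset.mem_filter.1 (hCT ha')).2 (hsymm _ _ h)
      · exact hC a ha' b hb' hab
    · rw [Finset.sum_insert hxC, mul_add, ← Finset.sum_filter_add_sum_filter_not T (near x)]
      refine add_le_add ?_ hw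
      calc ∑ y ∈ T.filter (near x), wt y ≤ ∑ _y ∈ T.filter (near x), wt x :=
            Finset.sum_le_sum fun y hy => hx y (Finset.mem_filter.1 hy).1
        _ = ((T.filter (near x)).card : ℝ) * wt x := by rw [Finset.sum_const, nsmul_eq_mul]
        _ ≤ N * wt x := by
            refine mul_le_mul_of_nonneg_right (le_trans ?_ (hN x)) (hwt x)
            exact_mod_cast Finset.card_le_card (Finset.filter_subset_filter _ (Finset.subset_univ T))

/-! ### Random binning -/

section Binning

variable {α β : Type*} [Fintype α] [DecidableEq α] [Fintype β]

/-- `K` times the indicator of a bin, centred. -/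
def binDev {K : ℕ} (a k : Fin K) : ℝ := (if k = a then (K : ℝ) else 0) - 1

/-- The mean over all assignments of bins. -/
def binMean (α : Type*) [Fintype α] [DecidableEq α] (K : ℕ) (Y : (α → Fin K) → ℝ) : ℝ :=
  ∑ F : α → Fin K, (∏ _x : α, (K : ℝ)⁻¹) * Y F

variable {K : ℕ}

theorem binMean_mono {Y Y' : (α → Fin K) → ℝ} (h : ∀ F, Y F ≤ Y' F) :
    binMean α K Y ≤ binMean α K Y' :=
  Finset.sum_le_sum fun F _ => mul_le_mul_of_nonneg_left (h F) (by positivity)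

theorem binMean_add (Y Y' : (α → Fin K) → ℝ) :
    binMean α K (fun F => Y F + Y' F) = binMean α K Y + binMean α K Y' := by
  simp [binMean, mul_add, Finset.sum_add_distrib]

theorem binMean_sum {ι : Type*} (s : Finset ι) (Y : ι → (α → Fin K) → ℝ) :
    binMean α K (fun F => ∑ i ∈ s, Y i F) = ∑ i ∈ s, binMean α K (Y i) := by
  simp only [binMean, Finset.mul_sum]
  exact Finset.sum_comm

theorem binMean_mul_left (c : ℝ) (Y : (α → Fin K) → ℝ) :
    binMean α K (fun F => c * Y F) = c * binMean α K Y := by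
  simp only [binMean, Finset.mul_sum]
  exact Finset.sum_congr rfl fun F _ => by ring

theorem sum_inv_fin (hK : 0 < K) : ∑ _k : Fin K, (K : ℝ)⁻¹ = 1 := by
  have : (K : ℝ) ≠ 0 := by positivity
  simp [this]

theorem binMean_const (hK : 0 < K) (c : ℝ) : binMean α K (fun _ => c) = c := by
  rw [binMean, ← Finset.sum_mul,
    sum_prod_eq_one (p := fun (_ : α) (_ : Fin K) => (K : ℝ)⁻¹) fun _ => sum_inv_fin hK, one_mul]

/-- The probabilistic method: an assignment of bins exists because the average one is good. -/
theorem exists_le_of_binMean_le (hK : 0 < K) {Y : (α → Fin K) → ℝ} {c : ℝ}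
    (h : binMean α K Y ≤ c) : ∃ F, Y F ≤ c := by
  by_contra hcon
  push Not at hcon
  have : Nonempty (Fin K) := ⟨⟨0, hK⟩⟩
  have h2 : binMean α K (fun _ => c) < binMean α K Y :=
    Finset.sum_lt_sum_of_nonempty Finset.univ_nonempty fun F _ =>
      mul_lt_mul_of_pos_left (hcon F) (Finset.prod_pos fun _ _ => by positivity)
  rw [binMean_const hK] at h2
  linarith

theorem sq_binMean_abs_le (hK : 0 < K) (Y : (α → Fin K) → ℝ) :
    binMean α K (fun F => |Y F|) ^ 2 ≤ binMean α K fun F => Y F ^ 2 := by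
  set m := binMean α K fun F => |Y F| with hm
  have h0 : 0 ≤ binMean α K fun F => (|Y F| - m) ^ 2 :=
    Finset.sum_nonneg fun F _ => by positivity
  have h1 : (fun F => (|Y F| - m) ^ 2) = fun F => (Y F ^ 2 + (-(2 * m)) * |Y F|) + m ^ 2 := by
    funext F
    rw [← sq_abs (Y F)]
    ring
  rw [h1, binMean_add, binMean_add, binMean_mul_left, binMean_const hK, ← hm] at h0
  nlinarith

theorem binMean_single (hK : 0 < K) (x : α) (h : Fin K → ℝ) :
    binMean α K (fun F => h (F x)) = ∑ k, (K : ℝ)⁻¹ * h k :=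
  sum_prod_mul_single (p := fun (_ : α) (_ : Fin K) => (K : ℝ)⁻¹) (fun _ => sum_inv_fin hK) x h

theorem mean_binDev (hK : 0 < K) (a : Fin K) : ∑ k, (K : ℝ)⁻¹ * binDev a k = 0 := by
  have : (K : ℝ) ≠ 0 := by positivity
  simp [binDev, mul_sub, Finset.sum_sub_distrib, this]

theorem mean_binDev_sq_le (hK : 0 < K) (a : Fin K) : ∑ k, (K : ℝ)⁻¹ * binDev a k ^ 2 ≤ K := by
  have h0 : (K : ℝ) ≠ 0 := by positivity
  have : ∀ k, (K : ℝ)⁻¹ * binDev a k ^ 2 = (if k = a then (K : ℝ) else 0) - 2 *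
      ((K : ℝ)⁻¹ * binDev a k) - (K : ℝ)⁻¹ := by
    intro k
    unfold binDev
    split_ifs
    · field_simp; ring
    · ring
  simp_rw [this, Finset.sum_sub_distrib, sum_inv_fin hK]
  rw [← Finset.mul_sum, mean_binDev hK a]
  simp

/-- Unlike the second moment, the first moment stays bounded as `K` grows; hence atypical pairs can
be treated by their mass alone. -/
theorem mean_abs_binDev_le (hK : 0 < K) (a : Fin K) : ∑ k, (K : ℝ)⁻¹ * |binDev a k| ≤ 2 := by
  have h0 : (K : ℝ) ≠ 0 := by positivity
  have : ∀ k, (K : ℝ)⁻¹ * |binDev a k| ≤ (if k = a then 1 else 0) + (K : ℝ)⁻¹ := by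
    intro k
    unfold binDev
    have hK' : (0 : ℝ) < K := by positivity
    calc (K : ℝ)⁻¹ * |(if k = a then (K : ℝ) else 0) - 1|
        ≤ (K : ℝ)⁻¹ * ((if k = a then (K : ℝ) else 0) + 1) := by
          refine mul_le_mul_of_nonneg_left ((abs_sub _ _).trans ?_) (by positivity)
          rw [abs_one, abs_of_nonneg]
          split_ifs <;> positivity
      _ = (if k = a then 1 else 0) + (K : ℝ)⁻¹ := by
          split_ifs
          · field_simp
          · simp
  refine (Finset.sum_le_sum fun k _ => this k).trans ?_
  rw [Finset.sum_add_distrib, sum_inv_fin hK]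
  simp
  norm_num

/-- The mean absolute deviation of the weight of a bin. -/
theorem binMean_abs_sum_le (hK : 0 < K) (a : Fin K) (c : α → ℝ) {θ q m : ℝ} (hθ : 0 ≤ θ)
    (hq : 0 ≤ q) (hm : 0 ≤ m) (hc : K * ∑ x, c x ^ 2 ≤ θ ^ 2 * (q * m)) :
    binMean α K (fun F => |∑ x, c x * binDev a (F x)|) ≤ θ * (q + m) / 2 := by
  refine (le_abs_self _).trans (abs_le_of_sq_le_sq ?_ (by positivity))
  refine (sq_binMean_abs_le hK _).trans ?_
  have h1 := sum_prod_mul_sq (p := fun (_ : α) (_ : Fin K) => (K : ℝ)⁻¹)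
    (g := fun x k => c x * binDev a k) (fun _ => sum_inv_fin hK) (fun x => by
      simp_rw [mul_left_comm _ (c x)]
      rw [← Finset.mul_sum, mean_binDev hK, mul_zero])
  refine h1.le.trans ?_
  have h2 : ∀ x, ∑ k : Fin K, (K : ℝ)⁻¹ * (c x * binDev a k) ^ 2 ≤ c x ^ 2 * K := by
    intro x
    simp_rw [mul_pow, mul_left_comm _ (c x ^ 2)]
    rw [← Finset.mul_sum]
    exact mul_le_mul_of_nonneg_left (mean_binDev_sq_le hK a) (sq_nonneg _)
  refine (Finset.sum_le_sum fun x _ => h2 x).trans ?_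
  rw [← Finset.sum_mul, mul_comm]
  refine hc.trans ?_
  -- The inequality of arithmetic and geometric means, `q * m ≤ ((q + m) / 2) ^ 2`; it makes the
  -- bound linear in `q` and `m`, ready to be summed over outputs.
  nlinarith [mul_nonneg (sq_nonneg θ) (sq_nonneg (q - m))]

/-- For most assignments of bins, most of the bins have nearly the output distribution of all
words. -/
theorem exists_binning (hK : 0 < K) {π : α → ℝ} (hπ0 : ∀ x, 0 ≤ π x) (hπ1 : ∑ x, π x = 1)
    {V : α → β → ℝ} (hV0 : ∀ x z, 0 ≤ V x z) (hV1 : ∀ x, ∑ z, V x z = 1)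
    {Q : β → ℝ} (hQ0 : ∀ z, 0 ≤ Q z) (hQ1 : ∑ z, Q z = 1) (G : α → β → Prop)
    [∀ x z, Decidable (G x z)] {θ κ : ℝ} (hθ : 0 ≤ θ)
    (hG : ∀ x z, G x z → K * (π x * V x z) ≤ θ ^ 2 * Q z)
    (hκ : ∑ x, ∑ z, (if G x z then 0 else π x * V x z) ≤ κ) :
    ∃ F : α → Fin K, ∑ a, ∑ z, |∑ x, π x * V x z * binDev a (F x)| ≤ K * (θ + 2 * κ) := by
  apply exists_le_of_binMean_le hK
  rw [binMean_sum]
  have key : ∀ a : Fin K, binMean α K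
      (fun F => ∑ z, |∑ x, π x * V x z * binDev a (F x)|) ≤ θ + 2 * κ := by
    intro a
    rw [binMean_sum]
    have hz : ∀ z, binMean α K (fun F => |∑ x, π x * V x z * binDev a (F x)|)
        ≤ θ * (Q z + ∑ x, π x * V x z) / 2
          + 2 * ∑ x, (if G x z then 0 else π x * V x z) := by
      intro z
      -- Truncation: pairs in `G` have small mass and are handled by the variance, the others by the
      -- first moment of `binDev`.
      have hsplit : ∀ F : α → Fin K, |∑ x, π x * V x z * binDev a (F x)|
          ≤ |∑ x, (if G x z then π x * V x z else 0) * binDev a (F x)|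
            + ∑ x, (if G x z then 0 else π x * V x z) * |binDev a (F x)| := by
        intro F
        have : ∑ x, π x * V x z * binDev a (F x)
            = ∑ x, (if G x z then π x * V x z else 0) * binDev a (F x)
              + ∑ x, (if G x z then 0 else π x * V x z) * binDev a (F x) := by
          rw [← Finset.sum_add_distrib]
          refine Finset.sum_congr rfl fun x _ => ?_
          split_ifs <;> ring
        rw [this]
        refine (abs_add_le _ _).trans (add_le_add le_rfl ?_)
        refine (Finset.abs_sum_le_sum_abs _ _).trans (Finset.sum_le_sum fun x _ => ?_)
        rw [abs_mul, abs_of_nonneg]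
        split_ifs
        · exact le_rfl
        · exact mul_nonneg (hπ0 x) (hV0 x z)
      refine (binMean_mono hsplit).trans ?_
      rw [binMean_add, binMean_sum]
      refine add_le_add ?_ ?_
      · refine binMean_abs_sum_le hK a _ hθ (hQ0 z)
          (Finset.sum_nonneg fun x _ => mul_nonneg (hπ0 x) (hV0 x z)) ?_
        rw [Finset.mul_sum, Finset.mul_sum, Finset.mul_sum]
        refine Finset.sum_le_sum fun x _ => ?_
        have h0 := mul_nonneg (hπ0 x) (hV0 x z)
        split_ifs with h
        · have := hG x z h
          nlinarith
        · have := mul_nonneg (sq_nonneg θ) (mul_nonneg (hQ0 z) h0)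
          simpa using this
      · rw [Finset.mul_sum]
        refine Finset.sum_le_sum fun x _ => ?_
        rw [binMean_mul_left, binMean_single hK x fun k => |binDev a k|, mul_comm]
        refine mul_le_mul_of_nonneg_right (mean_abs_binDev_le hK a) ?_
        split_ifs
        · exact le_rfl
        · exact mul_nonneg (hπ0 x) (hV0 x z)
    refine (Finset.sum_le_sum fun z _ => hz z).trans ?_
    rw [Finset.sum_add_distrib, ← Finset.sum_div, ← Finset.mul_sum, ← Finset.mul_sum,
      Finset.sum_add_distrib, hQ1, Finset.sum_comm]
    simp_rw [← Finset.mul_sum, hV1, mul_one]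
    rw [hπ1, Finset.sum_comm]
    linarith
  refine (Finset.sum_le_sum fun a _ => key a).trans (le_of_eq ?_)
  rw [Finset.sum_const, nsmul_eq_mul, Finset.card_univ, Fintype.card_fin]

end Binning

/-! ### Selecting good bins and normalising them -/

section Bins

variable {α β : Type*} [Fintype α] [DecidableEq α] [Fintype β]

theorem tvDist_fintype (p q : PMF β) :
    tvDist p q = (1 / 2) * ∑ b, |(p b).toReal - (q b).toReal| := by
  rw [tvDist, tsum_fintype]

/-- A random choice of a word can be split into many disjoint bins such that the words of
each bin have nearly the same output distribution. -/
theorem exists_bins {K : ℕ} (hK : 0 < K) (π : PMF α) (V : α → PMF β)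
    {Q : β → ℝ} (hQ0 : ∀ z, 0 ≤ Q z) (hQ1 : ∑ z, Q z = 1) (G : α → β → Prop)
    [∀ x z, Decidable (G x z)] {θ κ : ℝ} (hθ : 0 ≤ θ)
    (hG : ∀ x z, G x z → 2 * K * ((π x).toReal * (V x z).toReal) ≤ θ ^ 2 * Q z)
    (hκ : ∑ x, ∑ z, (if G x z then 0 else (π x).toReal * (V x z).toReal) ≤ κ)
    (hsmall : 2 * (θ + 2 * κ) < 1) :
    ∃ q : Fin K → PMF α, (∀ a x, x ∈ (q a).support → x ∈ π.support) ∧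
      (∀ a a' x, a ≠ a' → x ∈ (q a).support → x ∉ (q a').support) ∧
      ∀ a a', tvDist ((q a).bind V) ((q a').bind V) ≤ 4 * (θ + 2 * κ) := by
  set ξ := θ + 2 * κ with hξ
  have hπ0 : ∀ x, 0 ≤ (π x).toReal := fun x => ENNReal.toReal_nonneg
  have hV0 : ∀ x z, 0 ≤ (V x z).toReal := fun x z => ENNReal.toReal_nonneg
  have hV1 : ∀ x, ∑ z, (V x z).toReal = 1 := fun x => sum_toReal_pmf _
  have hK2 : 0 < 2 * K := by omega
  -- Twice as many bins as needed, so that the worse half can be dropped: the average of `D` is at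
  -- most `ξ`, hence at least `K` bins have `D a ≤ 2 * ξ`.
  obtain ⟨F, hF⟩ := exists_binning (K := 2 * K) hK2 hπ0 (sum_toReal_pmf π) hV0 hV1 hQ0 hQ1 G hθ
    (by push_cast; exact hG) hκ
  rw [← hξ] at hF
  set D : Fin (2 * K) → ℝ := fun a => ∑ z, |∑ x, (π x).toReal * (V x z).toReal *
    binDev a (F x)| with hD
  have hD0 : ∀ a, 0 ≤ D a := fun a => Finset.sum_nonneg fun z _ => abs_nonneg _
  have hξ0 : 0 ≤ ξ := by
    have h1 : (0 : ℝ) ≤ ((2 * K : ℕ) : ℝ) * ξ := (Finset.sum_nonneg fun a _ => hD0 a).trans hF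
    exact nonneg_of_mul_nonneg_right h1 (by positivity)
  set S := Finset.univ.filter fun a => D a ≤ 2 * ξ with hS
  have hcard : K ≤ S.card := by
    by_contra hlt
    have h1 := Finset.card_filter_add_card_filter_not (s := (Finset.univ : Finset (Fin (2 * K))))
      (fun a => D a ≤ 2 * ξ)
    rw [← hS, Finset.card_univ, Fintype.card_fin] at h1
    have h2 : K < (Finset.univ.filter fun a => ¬ D a ≤ 2 * ξ).card := by omega
    have h3 : ∑ _a ∈ Finset.univ.filter (fun a => ¬ D a ≤ 2 * ξ), 2 * ξ
        < ∑ a ∈ Finset.univ.filter (fun a => ¬ D a ≤ 2 * ξ), D a :=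
      Finset.sum_lt_sum_of_nonempty (Finset.card_pos.1 (by omega))
        fun a ha => not_le.1 (Finset.mem_filter.1 ha).2
    have h4 : ∑ a ∈ Finset.univ.filter (fun a => ¬ D a ≤ 2 * ξ), D a ≤ ∑ a, D a :=
      Finset.sum_le_sum_of_subset_of_nonneg (Finset.subset_univ _) fun a _ _ => hD0 a
    rw [Finset.sum_const, nsmul_eq_mul] at h3
    have h5 : (K : ℝ) * (2 * ξ) ≤ ((Finset.univ.filter fun a => ¬ D a ≤ 2 * ξ).card : ℝ) * (2 * ξ) :=
      mul_le_mul_of_nonneg_right (by exact_mod_cast h2.le) (by positivity)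
    push_cast at hF
    have h6 : ∑ a, D a ≤ 2 * K * ξ := hF
    nlinarith
  set e := S.orderEmbOfCardLe hcard with he
  have heS : ∀ a, D (e a) ≤ 2 * ξ := fun a =>
    (Finset.mem_filter.1 (S.orderEmbOfCardLe_mem hcard a)).2
  set u : Fin (2 * K) → α → ℝ := fun a x => (π x).toReal * (binDev a (F x) + 1) with hu
  have hind : ∀ a x, binDev a (F x) + 1 = if F x = a then ((2 * K : ℕ) : ℝ) else 0 := fun a x => by
    simp [binDev]
  have hu0 : ∀ a x, 0 ≤ u a x := by
    intro a x
    simp only [hu, hind]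
    refine mul_nonneg (hπ0 x) ?_
    split_ifs <;> positivity
  set s : Fin (2 * K) → ℝ := fun a => ∑ x, u a x with hs
  -- Summing the signed deviations over all outputs gives the deviation of the mass of the bin, so
  -- `D` also controls the normalisation.
  have hs1 : ∀ a, |1 - s a| ≤ D a := by
    intro a
    have : 1 - s a = - ∑ z, ∑ x, (π x).toReal * (V x z).toReal * binDev a (F x) := by
      rw [Finset.sum_comm]
      have h1 : ∀ x, ∑ z, (π x).toReal * (V x z).toReal * binDev a (F x)
          = (π x).toReal * binDev a (F x) := by
        intro x
        rw [← Finset.sum_mul, ← Finset.mul_sum, hV1, mul_one]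
      simp_rw [h1, hs, hu, mul_add, Finset.sum_add_distrib, mul_one]
      rw [sum_toReal_pmf]
      ring
    rw [this, abs_neg]
    exact Finset.abs_sum_le_sum_abs _ _
  have hspos : ∀ a, 0 < s (e a) := by
    intro a
    have := (hs1 (e a)).trans (heS a)
    rw [abs_le] at this
    linarith
  let q : Fin K → PMF α := fun a => pmfOfReal (fun x => u (e a) x / s (e a))
    (fun x => div_nonneg (hu0 _ _) (hspos a).le)
    (by rw [← Finset.sum_div]; exact div_self (hspos a).ne')
  have hsupp : ∀ a x, x ∈ (q a).support → x ∈ π.support ∧ F x = e a := by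
    intro a x hx
    have h1 : ((q a) x).toReal ≠ 0 := (ENNReal.toReal_ne_zero).2 ⟨hx, PMF.apply_ne_top _ _⟩
    simp only [q, pmfOfReal_toReal] at h1
    have h2 : u (e a) x ≠ 0 := fun h => h1 (by rw [h, zero_div])
    simp only [hu, hind] at h2
    constructor
    · intro h
      simp [h] at h2
    · by_contra h
      simp [h] at h2
  -- One `2 * ξ` comes from normalising the bin, the other from its deviation `D (e a)`.
  have hdist : ∀ a, ∑ z, |((q a).bind V z).toReal - (π.bind V z).toReal| ≤ 4 * ξ := by
    intro a
    have h1 : ∀ z, |((q a).bind V z).toReal - (π.bind V z).toReal|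
        ≤ |1 - s (e a)| * ∑ x, u (e a) x / s (e a) * (V x z).toReal
          + |∑ x, (π x).toReal * (V x z).toReal * binDev (e a) (F x)| := by
      intro z
      rw [bind_toReal, bind_toReal]
      simp only [q, pmfOfReal_toReal]
      have h2 : ∑ x, u (e a) x / s (e a) * (V x z).toReal - ∑ x, (π x).toReal * (V x z).toReal
          = (1 - s (e a)) * ∑ x, u (e a) x / s (e a) * (V x z).toReal
            + ∑ x, (π x).toReal * (V x z).toReal * binDev (e a) (F x) := by
        rw [Finset.mul_sum, ← Finset.sum_sub_distrib, ← Finset.sum_add_distrib]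
        refine Finset.sum_congr rfl fun x _ => ?_
        have := (hspos a).ne'
        simp only [hu]
        field_simp
        ring
      rw [h2]
      refine (abs_add_le _ _).trans (add_le_add (le_of_eq ?_) le_rfl)
      rw [abs_mul, abs_of_nonneg (a := ∑ x, u (e a) x / s (e a) * (V x z).toReal)]
      exact Finset.sum_nonneg fun x _ =>
        mul_nonneg (div_nonneg (hu0 _ _) (hspos a).le) (hV0 x z)
    refine (Finset.sum_le_sum fun z _ => h1 z).trans ?_
    rw [Finset.sum_add_distrib, ← Finset.mul_sum, Finset.sum_comm]
    simp_rw [← Finset.mul_sum, hV1, mul_one, ← Finset.sum_div]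
    have h3 : (∑ x, u (e a) x) / s (e a) = 1 := div_self (hspos a).ne'
    rw [h3, mul_one]
    have h4 := hs1 (e a)
    have h5 := heS a
    have h6 : ∑ z, |∑ x, (π x).toReal * (V x z).toReal * binDev (e a) (F x)| = D (e a) := rfl
    linarith
  refine ⟨q, fun a x hx => (hsupp a x hx).1, ?_, ?_⟩
  · intro a a' x haa' hx hx'
    exact haa' (e.injective ((hsupp a x hx).2.symm.trans (hsupp a' x hx').2))
  · intro a a'
    rw [tvDist_fintype]
    have h1 : ∑ z, |((q a).bind V z).toReal - ((q a').bind V z).toReal|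
        ≤ ∑ z, (|((q a).bind V z).toReal - (π.bind V z).toReal|
          + |((q a').bind V z).toReal - (π.bind V z).toReal|) := by
      refine Finset.sum_le_sum fun z _ => ?_
      rw [abs_sub_comm ((q a').bind V z).toReal]
      exact abs_sub_le _ _ _
    rw [Finset.sum_add_distrib] at h1
    linarith [hdist a, hdist a']

end Bins

/-! ### Backward probabilities and typicality -/

section Equivocation

variable {X Z : Type*}

theorem jointLaw_map_snd (W : X → PMF Z) (P : PMF X) :
    (jointLaw W P).map Prod.snd = P.bind W := by
  rw [jointLaw, PMF.map_bind]
  congr 1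
  funext x
  rw [PMF.map_comp]
  exact PMF.map_id _

/-- The conditional probability of the input `x` given the output `z`. -/
def backward (W : X → PMF Z) (P : PMF X) (x : X) (z : Z) : ℝ :=
  (P x).toReal * (W x z).toReal / (P.bind W z).toReal

theorem backward_nonneg (W : X → PMF Z) (P : PMF X) (x : X) (z : Z) : 0 ≤ backward W P x z :=
  div_nonneg (mul_nonneg ENNReal.toReal_nonneg ENNReal.toReal_nonneg) ENNReal.toReal_nonneg

variable [Fintype X]

theorem jointLaw_toReal (W : X → PMF Z) (P : PMF X) (x : X) (z : Z) :
    (jointLaw W P (x, z)).toReal = (P x).toReal * (W x z).toReal := by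
  classical
  rw [jointLaw, bind_toReal, Finset.sum_eq_single x]
  · congr 2
    rw [PMF.map_apply, tsum_eq_single z]
    · simp
    · intro z' hz'
      simp [hz'.symm]
  · intro y _ hy
    rw [PMF.map_apply]
    rw [ENNReal.tsum_eq_zero.2 fun z' => by simp [hy.symm]]
    simp
  · simp

theorem mul_le_bind_toReal (W : X → PMF Z) (P : PMF X) (x : X) (z : Z) :
    (P x).toReal * (W x z).toReal ≤ (P.bind W z).toReal := by
  rw [bind_toReal]
  exact Finset.single_le_sum (f := fun x => (P x).toReal * (W x z).toReal)
    (fun x _ => mul_nonneg ENNReal.toReal_nonneg ENNReal.toReal_nonneg) (Finset.mem_univ x)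

theorem backward_le_one (W : X → PMF Z) (P : PMF X) (x : X) (z : Z) : backward W P x z ≤ 1 :=
  div_le_one_of_le₀ (mul_le_bind_toReal W P x z) ENNReal.toReal_nonneg

theorem sum_backward_le_one (W : X → PMF Z) (P : PMF X) (z : Z) : ∑ x, backward W P x z ≤ 1 := by
  simp only [backward]
  rw [← Finset.sum_div, ← bind_toReal]
  exact div_self_le_one _

/-- Division by zero is harmless: where the output has mass `0`, the joint mass vanishes too. -/
theorem backward_mul (W : X → PMF Z) (P : PMF X) (x : X) (z : Z) :
    backward W P x z * (P.bind W z).toReal = (P x).toReal * (W x z).toReal := by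
  rcases eq_or_ne (P.bind W z).toReal 0 with h | h
  · have h1 := mul_le_bind_toReal W P x z
    have h2 : 0 ≤ (P x).toReal * (W x z).toReal :=
      mul_nonneg ENNReal.toReal_nonneg ENNReal.toReal_nonneg
    rw [h] at h1 ⊢
    linarith
  · rw [backward, div_mul_cancel₀ _ h]

theorem backward_pos {W : X → PMF Z} {P : PMF X} {x : X} {z : Z} (hx : P x ≠ 0)
    (hz : W x z ≠ 0) : 0 < backward W P x z := by
  have h1 : 0 < (P x).toReal * (W x z).toReal :=
    mul_pos (ENNReal.toReal_pos hx (P.apply_ne_top x))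
      (ENNReal.toReal_pos hz ((W x).apply_ne_top z))
  exact div_pos h1 (h1.trans_le (mul_le_bind_toReal W P x z))

/-- The equivocation is the mean of the negative logarithm of the backward probability. -/
theorem equivocation_eq [Fintype Z] (W : X → PMF Z) (P : PMF X) :
    equivocation W P
      = ∑ x, ∑ z, (P x).toReal * (W x z).toReal * (- Real.logb 2 (backward W P x z)) := by
  rw [equivocation, jointLaw_map_snd, entropy, entropy, Fintype.sum_prod_type]
  simp_rw [jointLaw_toReal]
  have h1 : ∑ z, (P.bind W z).toReal * Real.logb 2 (P.bind W z).toReal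
      = ∑ x, ∑ z, (P x).toReal * (W x z).toReal * Real.logb 2 (P.bind W z).toReal := by
    rw [Finset.sum_comm]
    refine Finset.sum_congr rfl fun z _ => ?_
    rw [← Finset.sum_mul, ← bind_toReal]
  rw [h1, neg_sub_neg, ← Finset.sum_sub_distrib]
  refine Finset.sum_congr rfl fun x _ => ?_
  rw [← Finset.sum_sub_distrib]
  refine Finset.sum_congr rfl fun z _ => ?_
  rw [← mul_sub]
  rcases eq_or_ne ((P x).toReal * (W x z).toReal) 0 with h | h
  · rw [h, zero_mul, zero_mul]
  · have h2 : (P.bind W z).toReal ≠ 0 := by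
      intro h0
      rw [← backward_mul, h0, mul_zero] at h
      exact h rfl
    rw [backward, Real.logb_div h h2]
    ring

theorem equivocation_nonneg [Fintype Z] (W : X → PMF Z) (P : PMF X) : 0 ≤ equivocation W P := by
  rw [equivocation_eq]
  refine Finset.sum_nonneg fun x _ => Finset.sum_nonneg fun z _ => mul_nonneg
    (mul_nonneg ENNReal.toReal_nonneg ENNReal.toReal_nonneg) ?_
  rw [neg_nonneg]
  exact Real.logb_nonpos one_lt_two (backward_nonneg _ _ _ _) (backward_le_one _ _ _ _)

/-- For most pairs of words the backward probability is at most about `2 ^ (- n H(X|Z))`. -/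
theorem exists_atypical_le [Fintype Z] (W : X → PMF Z) (P : PMF X) {γ : ℝ} (hγ : 0 < γ) :
    ∃ b : ℝ, 0 < b ∧ ∀ n : ℕ, 0 < n → ∑ x : Fin n → X, ∑ z : Fin n → Z,
      (if (∏ i, (P (x i)).toReal) * ∏ i, (W (x i) (z i)).toReal
          ≤ (2 : ℝ) ^ (-(n * (equivocation W P - γ))) * ∏ i, (P.bind W (z i)).toReal then 0
        else (∏ i, (P (x i)).toReal) * ∏ i, (W (x i) (z i)).toReal) ≤ b / n := by
  classical
  set g : X × Z → ℝ := fun c => Real.logb 2 (backward W P c.1 c.2) with hg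
  set b₀ : ℝ := ∑ c, |g c| with hb₀
  have hgb : ∀ c, |g c| ≤ b₀ := fun c =>
    Finset.single_le_sum (f := fun c => |g c|) (fun c _ => abs_nonneg _) (Finset.mem_univ c)
  -- The first term is Chebyshev's constant; the `+ 1` only makes it positive.
  refine ⟨b₀ ^ 2 / γ ^ 2 + 1, by positivity, fun n hn => ?_⟩
  set C := equivocation W P with hC
  have hn' : (0 : ℝ) < n := by positivity
  set p : X × Z → ℝ := fun c => (P c.1).toReal * (W c.1 c.2).toReal with hp
  have hp0 : ∀ c, 0 ≤ p c := fun c => mul_nonneg ENNReal.toReal_nonneg ENNReal.toReal_nonneg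
  have hp1 : ∑ c, p c = 1 := by
    rw [Fintype.sum_prod_type]
    simp only [hp]
    simp_rw [← Finset.mul_sum, sum_toReal_pmf, mul_one]
    exact sum_toReal_pmf P
  have hmean : ∑ c, p c * g c = - C := by
    rw [hC, equivocation_eq, Fintype.sum_prod_type, ← Finset.sum_neg_distrib]
    refine Finset.sum_congr rfl fun x _ => ?_
    rw [← Finset.sum_neg_distrib]
    refine Finset.sum_congr rfl fun z _ => ?_
    simp only [hp, hg]
    ring
  have hcheb := sum_prod_le_of_deviation (ι := Fin n) (p := fun _ => p) (g := fun _ => g)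
    (b := b₀) (t := n * γ) (fun _ => hp0) (fun _ => hp1) (fun _ => hgb) (by positivity)
    (fun F => -(n * (C - γ)) ≤ ∑ i, g (F i)) (fun F hF => by
      simp only [hmean]
      rw [Finset.sum_const, Finset.card_univ, Fintype.card_fin, nsmul_eq_mul]
      refine le_trans ?_ (le_abs_self _)
      linarith)
  rw [Fintype.card_fin] at hcheb
  have hbound : (n : ℝ) * b₀ ^ 2 / (n * γ) ^ 2 ≤ (b₀ ^ 2 / γ ^ 2 + 1) / n := by
    have : (n : ℝ) * b₀ ^ 2 / (n * γ) ^ 2 = (b₀ ^ 2 / γ ^ 2) / n := by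
      field_simp
    rw [this]
    gcongr
    linarith
  refine le_trans ?_ (hcheb.trans hbound)
  rw [← Fintype.sum_prod_type']
  refine le_of_eq_of_le (Fintype.sum_equiv (Equiv.arrowProdEquivProdArrow (Fin n) (fun _ => X)
    (fun _ => Z)).symm _ (fun F : Fin n → X × Z =>
      if ∏ i, p (F i) ≤ (2 : ℝ) ^ (-(n * (C - γ))) * ∏ i, (P.bind W (F i).2).toReal then 0
      else ∏ i, p (F i)) ?_) ?_
  · rintro ⟨x, z⟩
    simp [Equiv.arrowProdEquivProdArrow, hp, Finset.prod_mul_distrib]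
  · refine Finset.sum_le_sum fun F _ => ?_
    have hprod0 : 0 ≤ ∏ i, p (F i) := Finset.prod_nonneg fun i _ => hp0 _
    split_ifs with h1 h2 h2
    · exact hprod0
    · exact le_rfl
    · exact le_rfl
    · exfalso
      apply h1
      -- Pairs of mass `0` satisfy the inequality trivially; on the others all backward
      -- probabilities are positive, so their logarithms can be exponentiated.
      rcases hprod0.eq_or_lt with h0 | h0
      · rw [← h0]
        exact mul_nonneg (by positivity) (Finset.prod_nonneg fun i _ => ENNReal.toReal_nonneg)
      have hpos : ∀ i, 0 < p (F i) := fun i =>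
        lt_of_le_of_ne (hp0 _) fun h => h0.ne' (Finset.prod_eq_zero (Finset.mem_univ i) h.symm)
      have hfac : ∀ i, p (F i) = (2 : ℝ) ^ (g (F i)) * (P.bind W (F i).2).toReal := by
        intro i
        have hb : 0 < backward W P (F i).1 (F i).2 :=
          div_pos (hpos i) ((hpos i).trans_le (mul_le_bind_toReal W P _ _))
        rw [hg, Real.rpow_logb two_pos (by norm_num) hb, backward_mul]
      rw [Finset.prod_congr rfl fun i _ => hfac i, Finset.prod_mul_distrib,
        ← Real.rpow_sum_of_pos two_pos]
      refine mul_le_mul_of_nonneg_right ?_ (Finset.prod_nonneg fun i _ => ENNReal.toReal_nonneg)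
      exact Real.rpow_le_rpow_of_exponent_le one_le_two (not_le.1 h2).le

end Equivocation

/-! ### Good codes and the direct part -/

section Achievability

/-- Hamming balls of small relative radius have few elements. -/
theorem exists_radius (X : Type*) [Fintype X] [Nonempty X] [DecidableEq X] {γ : ℝ} (hγ : 0 < γ) :
    ∃ σ : ℝ, 0 < σ ∧ ∀ (n : ℕ) (x : Fin n → X),
      ((Finset.univ.filter fun y : Fin n → X => (hammingDist x y : ℝ) < 4 * σ * n).card : ℝ)
        ≤ (2 : ℝ) ^ (γ * n) := by
  have hcard : (0 : ℝ) < Fintype.card X := by exact_mod_cast Fintype.card_pos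
  have h2 : (1 : ℝ) < 2 ^ (γ / 2) := Real.one_lt_rpow one_lt_two (by positivity)
  -- Half of the exponent `γ` bounds `(1 + |X| s) ^ n`, the other half pays for `s ^ (-4 σ n)`.
  set s : ℝ := min 1 ((2 ^ (γ / 2) - 1) / Fintype.card X) with hs
  have hs0 : 0 < s := lt_min one_pos (div_pos (by linarith) hcard)
  have hs1 : s ≤ 1 := min_le_left _ _
  have hs2 : 1 + Fintype.card X * s ≤ 2 ^ (γ / 2) := by
    have : s ≤ (2 ^ (γ / 2) - 1) / Fintype.card X := min_le_right _ _
    rw [le_div_iff₀ hcard] at this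
    linarith
  set l := - Real.logb 2 s with hl
  have hl0 : 0 ≤ l := by
    rw [hl, neg_nonneg]
    exact Real.logb_nonpos one_lt_two hs0.le hs1
  have hsl : s = 2 ^ (-l) := by
    rw [hl, neg_neg, Real.rpow_logb two_pos (by norm_num) hs0]
  -- `l + 1` instead of `l`, because `l = 0` when `s = 1`.
  refine ⟨γ / (8 * (l + 1)), by positivity, fun n x => ?_⟩
  have h := card_hammingBall_le x hs0 hs1 (4 * (γ / (8 * (l + 1))) * n)
  have hlow : (2 : ℝ) ^ (-(γ / 2 * n)) ≤ s ^ (4 * (γ / (8 * (l + 1))) * n) := by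
    rw [hsl, ← Real.rpow_mul two_pos.le]
    refine Real.rpow_le_rpow_of_exponent_le one_le_two ?_
    have : l * (4 * (γ / (8 * (l + 1))) * n) ≤ γ / 2 * n := by
      have h3 : l * (4 * (γ / (8 * (l + 1))) * n) = (l / (l + 1)) * (γ / 2 * n) := by
        field_simp
        ring
      rw [h3]
      exact mul_le_of_le_one_left (by positivity) (div_le_one_of_le₀ (by linarith) (by linarith))
    linarith
  have hup : (1 + Fintype.card X * s) ^ n ≤ (2 : ℝ) ^ (γ / 2 * n) := by
    rw [Real.rpow_mul two_pos.le, Real.rpow_natCast]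
    exact pow_le_pow_left₀ (by positivity) hs2 n
  have h5 := (mul_le_mul_of_nonneg_left hlow (Nat.cast_nonneg _)).trans (h.trans hup)
  rw [Real.rpow_neg two_pos.le, ← div_eq_mul_inv, div_le_iff₀ (by positivity),
    ← Real.rpow_add two_pos] at h5
  refine h5.trans (le_of_eq ?_)
  congr 1
  ring

variable {X Z : Type*} [Fintype Z]

/-- The outputs of the word `x` fit to `x`. -/
theorem prob_wordLaw_not_fit_le {W : X → PMF Z} {f : X → Z → ℝ} {b σ : ℝ}
    (hb : ∀ x z, |f x z| ≤ b) (h0 : ∀ y, ∑ z, (W y z).toReal * f y z = 0) (hσ : 0 < σ) {n : ℕ}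
    (hn : 0 < n) (x : Fin n → X) :
    prob (wordLaw W x) (fun z => ¬ ∑ i, f (x i) (z i) < σ * n) ≤ b ^ 2 / σ ^ 2 / n := by
  classical
  rw [prob_fintype]
  simp_rw [wordLaw_toReal]
  have hn' : (0 : ℝ) < n := by positivity
  refine (sum_prod_le_of_deviation (p := fun i z => (W (x i) z).toReal)
    (g := fun i z => f (x i) z) (b := b) (t := σ * n) (fun _ _ => ENNReal.toReal_nonneg)
    (fun i => sum_toReal_pmf _) (fun i z => hb _ _) (by positivity) _ fun z hz => ?_).trans ?_
  · simp only [h0, Finset.sum_const_zero, sub_zero]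
    exact (not_lt.1 hz).trans (le_abs_self _)
  · rw [Fintype.card_fin]
    refine le_of_eq ?_
    field_simp

/-- The outputs of a word which is far from `x` do not fit to `x`. -/
theorem prob_wordLaw_fit_le [DecidableEq X] {W : X → PMF Z} {f : X → Z → ℝ} {b σ : ℝ}
    (hb : ∀ x z, |f x z| ≤ b) (h0 : ∀ y, ∑ z, (W y z).toReal * f y z = 0)
    (h1 : ∀ x y, x ≠ y → 1 ≤ ∑ z, (W x z).toReal * f y z) (hσ : 0 < σ) {n : ℕ}
    (hn : 0 < n) {x y : Fin n → X} (hxy : 2 * σ * n ≤ hammingDist y x) :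
    prob (wordLaw W y) (fun z => ∑ i, f (x i) (z i) < σ * n) ≤ b ^ 2 / σ ^ 2 / n := by
  classical
  rw [prob_fintype]
  simp_rw [wordLaw_toReal]
  have hn' : (0 : ℝ) < n := by positivity
  have hmean : (hammingDist y x : ℝ) ≤ ∑ i, ∑ z, (W (y i) z).toReal * f (x i) z := by
    rw [hammingDist, Finset.cast_card, Finset.sum_filter]
    refine Finset.sum_le_sum fun i _ => ?_
    split_ifs with h
    · exact h1 _ _ h
    · rw [not_not.1 h, h0]
  refine (sum_prod_le_of_deviation (p := fun i z => (W (y i) z).toReal)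
    (g := fun i z => f (x i) z) (b := b) (t := σ * n) (fun _ _ => ENNReal.toReal_nonneg)
    (fun i => sum_toReal_pmf _) (fun i z => hb _ _) (by positivity) _ fun z hz => ?_).trans ?_
  · rw [abs_sub_comm]
    refine le_trans ?_ (le_abs_self _)
    linarith
  · rw [Fintype.card_fin]
    refine le_of_eq ?_
    field_simp

/-- Every rate below an equivocation is the rate of good codes. -/
theorem exists_bins_of_lt_equivocation [Fintype X] [Nonempty X] [DecidableEq X]
    (W : X → PMF Z) (P : PMF X) {R : ℝ} (hR0 : 0 ≤ R) (hR : R < equivocation W P) :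
    ∃ (σ : ℝ) (ε : ℕ → ℝ), 0 < σ ∧ (∀ n, 0 ≤ ε n) ∧ Filter.Tendsto ε Filter.atTop (𝓝 0) ∧
      ∀ᶠ n : ℕ in Filter.atTop, 0 < n ∧ ∃ (m : ℕ) (e : Fin m → Fin n → X)
        (q : Fin ⌈(2 : ℝ) ^ (n * R)⌉₊ → PMF (Fin m)),
        (∀ a a' x y, a ≠ a' → x ∈ (q a).support → y ∈ (q a').support →
          4 * σ * n ≤ hammingDist (e x) (e y)) ∧
        ∀ a a', tvDist ((q a).bind fun x => wordLaw W (e x))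
          ((q a').bind fun x => wordLaw W (e x)) ≤ ε n := by
  classical
  set C := equivocation W P with hC
  -- Of the gap `4 * γ`, one `γ` is lost to typicality, one to the packing, and two remain for `θ ^
  -- 2`.
  set γ := (C - R) / 4 with hγdef
  have hγ : 0 < γ := by rw [hγdef]; linarith
  obtain ⟨σ, hσ, hball⟩ := exists_radius X hγ
  obtain ⟨b, hb, htyp⟩ := exists_atypical_le W P hγ
  set ξ : ℕ → ℝ := fun n => 3 * (2 : ℝ) ^ (-(γ * n)) + 2 * (2 * b / n) with hξ
  have hξ0 : ∀ n, 0 ≤ ξ n := fun n => by positivity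
  have hlim : Filter.Tendsto ξ Filter.atTop (𝓝 0) := by
    have h1 : Filter.Tendsto (fun n : ℕ => (2 : ℝ) ^ (-(γ * n))) Filter.atTop (𝓝 0) := by
      have h2 : ∀ n : ℕ, (2 : ℝ) ^ (-(γ * n)) = ((2 : ℝ) ^ (-γ)) ^ n := by
        intro n
        rw [← Real.rpow_natCast, ← Real.rpow_mul two_pos.le, neg_mul]
      simp_rw [h2]
      exact tendsto_pow_atTop_nhds_zero_of_lt_one (by positivity)
        (Real.rpow_lt_one_of_one_lt_of_neg one_lt_two (by linarith))
    have h2 := tendsto_const_div_atTop_nhds_zero_nat (2 * b)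
    have := (h1.const_mul 3).add (h2.const_mul 2)
    simpa using this
  refine ⟨σ, fun n => 4 * ξ n, hσ, fun n => by have := hξ0 n; positivity,
    by simpa using hlim.const_mul 4, ?_⟩
  have hev : ∀ᶠ n in Filter.atTop, ξ n < 1 / 2 := hlim.eventually (gt_mem_nhds (by norm_num))
  filter_upwards [hev, Filter.eventually_gt_atTop 0] with n hsmall hn
  refine ⟨hn, ?_⟩
  have hn' : (0 : ℝ) < n := by positivity
  set Pw : (Fin n → X) → ℝ := fun x => ∏ i, (P (x i)).toReal with hPw
  have hPw0 : ∀ x, 0 ≤ Pw x := fun x => Finset.prod_nonneg fun _ _ => ENNReal.toReal_nonneg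
  have hPw1 : ∑ x, Pw x = 1 :=
    sum_prod_eq_one (p := fun (_ : Fin n) x => (P x).toReal) fun _ => sum_toReal_pmf P
  set Q : (Fin n → Z) → ℝ := fun z => ∏ i, (P.bind W (z i)).toReal with hQ
  have hQ0 : ∀ z, 0 ≤ Q z := fun x => Finset.prod_nonneg fun _ _ => ENNReal.toReal_nonneg
  have hQ1 : ∑ z, Q z = 1 :=
    sum_prod_eq_one (p := fun (_ : Fin n) z => (P.bind W z).toReal) fun _ => sum_toReal_pmf _
  set G : (Fin n → X) → (Fin n → Z) → Prop := fun x z =>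
    Pw x * ∏ i, (W (x i) (z i)).toReal ≤ (2 : ℝ) ^ (-(n * (C - γ))) * Q z with hG
  set bad : (Fin n → X) → ℝ := fun x => ∑ z, if G x z then 0 else ∏ i, (W (x i) (z i)).toReal
    with hbad
  have hbadsum : ∑ x, Pw x * bad x ≤ b / n := by
    refine le_trans (le_of_eq ?_) (htyp n hn)
    refine Finset.sum_congr rfl fun x _ => ?_
    rw [hbad, Finset.mul_sum]
    refine Finset.sum_congr rfl fun z _ => ?_
    rw [mul_ite, mul_zero]
  have hbad0 : ∀ x, 0 ≤ bad x := by
    intro x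
    refine Finset.sum_nonneg fun z _ => ?_
    split_ifs
    · exact le_rfl
    · exact Finset.prod_nonneg fun _ _ => ENNReal.toReal_nonneg
  -- The packing may have exponentially small probability, so an average bound on the atypical mass
  -- would not survive conditioning on it. Hence the bound is imposed on each word; by Markov's
  -- inequality this keeps half of the weight.
  set T := Finset.univ.filter fun x => bad x ≤ 2 * b / n with hT
  have hTw : 1 / 2 ≤ ∑ x ∈ T, Pw x := by
    have h1 := Finset.sum_filter_add_sum_filter_not Finset.univ (fun x => bad x ≤ 2 * b / n) Pw
    rw [hPw1] at h1
    have h2 : (∑ x ∈ Finset.univ.filter (fun x => ¬ bad x ≤ 2 * b / n), Pw x) * (2 * b / n)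
        ≤ b / n := by
      rw [Finset.sum_mul]
      refine le_trans (Finset.sum_le_sum fun x hx => ?_) ((Finset.sum_le_sum_of_subset_of_nonneg
        (Finset.subset_univ _) fun x _ _ => mul_nonneg (hPw0 x) (hbad0 x)).trans hbadsum)
      exact mul_le_mul_of_nonneg_left (not_le.1 (Finset.mem_filter.1 hx).2).le (hPw0 x)
    have h3 : 0 < b / n := by positivity
    have h4 : 1 / 2 * (2 * b / n) = b / n := by ring
    rw [← h4] at h2
    have h5 := le_of_mul_le_mul_right h2 (by positivity)
    linarith
  obtain ⟨D, hDT, hDsep, hDw⟩ := exists_packing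
    (fun x y : Fin n → X => (hammingDist x y : ℝ) < 4 * σ * n)
    (fun x => by rw [hammingDist_self, Nat.cast_zero]; positivity)
    (fun x y h => by rwa [hammingDist_comm]) Pw hPw0 (hball n) T
  set c₀ := ∑ x ∈ D, Pw x with hc₀
  have hc₀' : 1 / 2 ≤ (2 : ℝ) ^ (γ * n) * c₀ := hTw.trans hDw
  have hc₀pos : 0 < c₀ := by
    by_contra h
    have : (2 : ℝ) ^ (γ * n) * c₀ ≤ 0 :=
      mul_nonpos_of_nonneg_of_nonpos (by positivity) (not_lt.1 h)
    linarith
  set e := (Fintype.equivFin (Fin n → X)).symm with he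
  have hsumE : ∀ h : (Fin n → X) → ℝ, ∑ k, h (e k) = ∑ x, h x := fun h => e.sum_comp h
  set w : (Fin n → X) → ℝ := fun x => if x ∈ D then Pw x / c₀ else 0 with hw
  have hw0 : ∀ x, 0 ≤ w x := by
    intro x
    simp only [hw]
    split_ifs
    · exact div_nonneg (hPw0 x) hc₀pos.le
    · exact le_rfl
  have hw1 : ∑ x, w x = 1 := by
    simp only [hw]
    rw [← Finset.sum_filter, Finset.filter_mem_eq_inter, Finset.univ_inter, ← Finset.sum_div,
      div_self hc₀pos.ne']
  set π : PMF (Fin (Fintype.card (Fin n → X))) := pmfOfReal (fun k => w (e k)) (fun k => hw0 _)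
    ((hsumE w).trans hw1) with hπ
  have hKle : (⌈(2 : ℝ) ^ (n * R)⌉₊ : ℝ) ≤ 2 * 2 ^ (n * R) := by
    have h1 : (1 : ℝ) ≤ 2 ^ (n * R) := Real.one_le_rpow one_le_two (by positivity)
    have := (Nat.ceil_lt_add_one (zero_le_one.trans h1)).le
    linarith
  have hKpos : 0 < ⌈(2 : ℝ) ^ (n * R)⌉₊ := Nat.ceil_pos.2 (by positivity)
  -- `Q` is the output law for independent inputs, not the one induced by `π`. Doubling the bins,
  -- rounding `K` up and the weight of `T` each cost a factor `2`, and `8 ≤ 3 ^ 2` explains the `3`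
  -- in `θ`.
  obtain ⟨q, hq1, hq2, hq3⟩ := exists_bins hKpos π (fun k => wordLaw W (e k)) hQ0 hQ1
    (fun k z => G (e k) z) (θ := 3 * (2 : ℝ) ^ (-(γ * n))) (κ := 2 * b / n) (by positivity)
    (by
      intro k z hgood
      rw [wordLaw_toReal, hπ, pmfOfReal_toReal]
      simp only [hw]
      split_ifs with hk
      · have hgood' : Pw (e k) * ∏ i, (W (e k i) (z i)).toReal
            ≤ (2 : ℝ) ^ (-(n * (C - γ))) * Q z := hgood
        have hinv : 1 / c₀ ≤ 2 * (2 : ℝ) ^ (γ * n) := by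
          rw [div_le_iff₀ hc₀pos]
          linarith
        have hexp : (2 : ℝ) ^ (n * R) * ((2 : ℝ) ^ (γ * n) * (2 : ℝ) ^ (-(n * (C - γ))))
            = ((2 : ℝ) ^ (-(γ * n))) ^ 2 := by
          rw [← Real.rpow_natCast, ← Real.rpow_mul two_pos.le, ← Real.rpow_add two_pos,
            ← Real.rpow_add two_pos]
          congr 1
          rw [hγdef]
          push_cast
          ring
        have hprod : 0 ≤ Pw (e k) * ∏ i, (W (e k i) (z i)).toReal :=
          mul_nonneg (hPw0 _) (Finset.prod_nonneg fun _ _ => ENNReal.toReal_nonneg)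
        calc 2 * (⌈(2 : ℝ) ^ (n * R)⌉₊ : ℝ) *
              (Pw (e k) / c₀ * ∏ i, (W (e k i) (z i)).toReal)
            = 2 * (⌈(2 : ℝ) ^ (n * R)⌉₊ : ℝ) *
              (1 / c₀ * (Pw (e k) * ∏ i, (W (e k i) (z i)).toReal)) := by ring
          _ ≤ 2 * (2 * (2 : ℝ) ^ (n * R)) *
              (2 * (2 : ℝ) ^ (γ * n) * ((2 : ℝ) ^ (-(n * (C - γ))) * Q z)) := by gcongr
          _ = 8 * ((2 : ℝ) ^ (n * R) * ((2 : ℝ) ^ (γ * n) * (2 : ℝ) ^ (-(n * (C - γ))))) * Q z := by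
              ring
          _ ≤ (3 * (2 : ℝ) ^ (-(γ * n))) ^ 2 * Q z := by
              rw [hexp, mul_pow]
              refine mul_le_mul_of_nonneg_right ?_ (hQ0 z)
              nlinarith [sq_nonneg ((2 : ℝ) ^ (-(γ * n)))]
      · have := mul_nonneg (sq_nonneg (3 * (2 : ℝ) ^ (-(γ * n)))) (hQ0 z)
        simpa using this)
    (by
      have h1 : ∀ k, ∑ z, (if G (e k) z then 0 else (π k).toReal * (wordLaw W (e k) z).toReal)
          = w (e k) * bad (e k) := by
        intro k
        rw [hbad, Finset.mul_sum, hπ, pmfOfReal_toReal]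
        refine Finset.sum_congr rfl fun z _ => ?_
        rw [wordLaw_toReal, mul_ite, mul_zero]
      simp_rw [h1]
      rw [hsumE fun x => w x * bad x]
      calc ∑ x, w x * bad x ≤ ∑ x, w x * (2 * b / n) := by
            refine Finset.sum_le_sum fun x _ => ?_
            by_cases hx : x ∈ D
            · exact mul_le_mul_of_nonneg_left (Finset.mem_filter.1 (hDT hx)).2 (hw0 x)
            · simp [hw, hx]
        _ = 2 * b / n := by rw [← Finset.sum_mul, hw1, one_mul])
    (by
      have : ξ n = 3 * (2 : ℝ) ^ (-(γ * n)) + 2 * (2 * b / n) := rfl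
      linarith)
  have hsuppD : ∀ k, k ∈ π.support → e k ∈ D := by
    intro k hk
    by_contra h
    apply hk
    have : (π k).toReal = 0 := by
      rw [hπ, pmfOfReal_toReal]
      simp [hw, h]
    rcases (ENNReal.toReal_eq_zero_iff _).1 this with h0 | h0
    · exact h0
    · exact absurd h0 (π.apply_ne_top k)
  refine ⟨_, fun k => e k, q, fun a a' x y haa' hx hy => ?_, hq3⟩
  refine not_lt.1 (hDsep _ (hsuppD x (hq1 a x hx)) _ (hsuppD y (hq1 a' y hy)) fun h => ?_)
  have hxy : x = y := e.injective h
  exact hq2 a a' x haa' hx (hxy ▸ hy)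

/-- A protocol for the commitment to one message. -/
theorem exists_trivial_protocol [Nonempty X] (W : X → PMF Z) (n : ℕ) {ε δ : ℝ} (hε : 0 ≤ ε)
    (hδ : 0 ≤ δ) : ∃ p : Protocol X Z n, Nat.card p.Msg = 1 ∧ (∀ B, p.SentBounded B) ∧
      p.Concealing W ε ∧ p.Binding W δ := by
  refine ⟨codeProtocol (A := Unit) (B := Unit) (fun _ => PMF.pure ())
    (fun _ _ => Classical.arbitrary X) (fun _ _ => True), by simp,
    codeProtocol_spec W _ _ _ hδ ?_ ?_ ?_⟩
  · intro a a'
    simpa [tvDist] using hε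
  · intro b
    have : prob (wordLaw W fun _ : Fin n => Classical.arbitrary X) (fun _ => ¬ True) = 0 := by
      simp [prob]
    exact this.le.trans hδ
  · intro a a' _ _ h
    exact absurd rfl h

/-- Every rate below an equivocation is achievable without noiseless communication. -/
theorem achievable_of_lt_equivocation [Fintype X] [Nonempty X] {W : X → PMF Z} (hW : NonRedundant W)
    (P : PMF X) {R : ℝ} (hR0 : 0 ≤ R) (hR : R < equivocation W P) (B : ℝ≥0∞) :
    Achievable W B R := by
  classical
  obtain ⟨f, hf⟩ := hW.exists_separating
  obtain ⟨σ, ε, hσ, hε0, hε, hev⟩ := exists_bins_of_lt_equivocation W P hR0 hR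
  set b : ℝ := ∑ x, ∑ z, |f x z| with hbdef
  have hb : ∀ x z, |f x z| ≤ b := fun x z =>
    (Finset.single_le_sum (f := fun z => |f x z|) (fun _ _ => abs_nonneg _)
      (Finset.mem_univ z)).trans (Finset.single_le_sum (f := fun x => ∑ z, |f x z|)
        (fun _ _ => Finset.sum_nonneg fun _ _ => abs_nonneg _) (Finset.mem_univ x))
  set δ : ℕ → ℝ := fun n => b ^ 2 / σ ^ 2 / n with hδ
  have hδ0 : ∀ n, 0 ≤ δ n := fun n => by positivity
  have hgood : ∀ᶠ n : ℕ in Filter.atTop, ∃ p : Protocol X Z n,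
      Nat.card p.Msg = ⌈(2 : ℝ) ^ (n * R)⌉₊ ∧ (∀ B, p.SentBounded B) ∧
        p.Concealing W (ε n) ∧ p.Binding W (δ n) := by
    filter_upwards [hev] with n ⟨hn, m, e, q, hq1, hq2⟩
    have : Nonempty (Fin ⌈(2 : ℝ) ^ (n * R)⌉₊) := ⟨⟨0, Nat.ceil_pos.2 (by positivity)⟩⟩
    refine ⟨codeProtocol q e fun x z => ∑ i, f (x i) (z i) < σ * n, by simp,
      codeProtocol_spec W q e _ (hδ0 n) hq2 ?_ ?_⟩
    · exact fun k => prob_wordLaw_not_fit_le hb (fun y => (hf y).1) hσ hn (e k)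
    · intro a a' k k' haa' hk hk' y
      have htri : (hammingDist (e k) (e k') : ℝ) ≤ hammingDist y (e k) + hammingDist y (e k') := by
        rw [hammingDist_comm y]
        exact_mod_cast hammingDist_triangle _ _ _
      have hsep := hq1 a a' k k' haa' hk hk'
      -- No word `y` lies within half the minimal distance of two codewords, so one of the two
      -- claims is rejected with high probability.
      have hfar : 2 * σ * n ≤ hammingDist y (e k) ∨ 2 * σ * n ≤ hammingDist y (e k') := by
        by_contra hcon
        push Not at hcon
        linarith [hcon.1, hcon.2]
      rcases hfar with h | h
      · exact (prob_mono _ fun z hz => hz.1).trans (prob_wordLaw_fit_le hb (fun y => (hf y).1)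
          (fun x y hxy => (hf y).2 x hxy) hσ hn h)
      · exact (prob_mono _ fun z hz => hz.2).trans (prob_wordLaw_fit_le hb (fun y => (hf y).1)
          (fun x y hxy => (hf y).2 x hxy) hσ hn h)
  -- Achievability asks for a protocol for every `n`; where no good code is available, a single
  -- message is committed to, which does not affect the limit.
  have hall : ∀ n, ∃ p : Protocol X Z n, ((∃ p : Protocol X Z n,
      Nat.card p.Msg = ⌈(2 : ℝ) ^ (n * R)⌉₊ ∧ (∀ B, p.SentBounded B) ∧
        p.Concealing W (ε n) ∧ p.Binding W (δ n)) → Nat.card p.Msg = ⌈(2 : ℝ) ^ (n * R)⌉₊) ∧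
      (∀ B, p.SentBounded B) ∧ p.Concealing W (ε n) ∧ p.Binding W (δ n) := by
    intro n
    by_cases h : ∃ p : Protocol X Z n,
      Nat.card p.Msg = ⌈(2 : ℝ) ^ (n * R)⌉₊ ∧ (∀ B, p.SentBounded B) ∧
        p.Concealing W (ε n) ∧ p.Binding W (δ n)
    · obtain ⟨p, hp1, hp2⟩ := h
      exact ⟨p, fun _ => hp1, hp2⟩
    · obtain ⟨p, -, hp2⟩ := exists_trivial_protocol W n (hε0 n) (hδ0 n)
      exact ⟨p, fun h' => absurd h' h, hp2⟩
  choose p hp1 hp2 using hall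
  refine ⟨p, ε, δ, fun n => ⟨(hp2 n).1 B, (hp2 n).2⟩, ?_, hε,
    tendsto_const_div_atTop_nhds_zero_nat _⟩
  -- Rounding up at most doubles `2 ^ (n R)`, which adds at most one bit, that is `1 / n` to the
  -- rate.
  have hup : Filter.Tendsto (fun n : ℕ => R + 1 / n) Filter.atTop (𝓝 R) := by
    simpa using tendsto_const_nhds.add (tendsto_const_div_atTop_nhds_zero_nat (1 : ℝ))
  refine tendsto_of_tendsto_of_tendsto_of_le_of_le' tendsto_const_nhds hup ?_ ?_
  · filter_upwards [hgood, Filter.eventually_gt_atTop 0] with n hg hn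
    have hn' : (0 : ℝ) < n := by positivity
    rw [Protocol.rate, hp1 n hg, le_div_iff₀ hn', Real.le_logb_iff_rpow_le one_lt_two
      (by exact_mod_cast Nat.ceil_pos.2 (by positivity)), mul_comm]
    exact Nat.le_ceil _
  · filter_upwards [hgood, Filter.eventually_gt_atTop 0] with n hg hn
    have hn' : (0 : ℝ) < n := by positivity
    have h1 : (1 : ℝ) ≤ 2 ^ (n * R) := Real.one_le_rpow one_le_two (by positivity)
    rw [Protocol.rate, hp1 n hg, div_le_iff₀ hn', Real.logb_le_iff_le_rpow one_lt_two
      (by exact_mod_cast Nat.ceil_pos.2 (by positivity))]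
    have h2 : (R + 1 / n) * n = n * R + 1 := by field_simp
    rw [h2, Real.rpow_add two_pos, Real.rpow_one]
    have := (Nat.ceil_lt_add_one (zero_le_one.trans h1)).le
    linarith

/-- The rate zero is achievable. -/
theorem achievable_zero [Nonempty X] (W : X → PMF Z) (B : ℝ≥0∞) : Achievable W B 0 := by
  choose p hp using fun n => exists_trivial_protocol W n le_rfl le_rfl
  refine ⟨p, fun _ => 0, fun _ => 0, fun n => ⟨(hp n).2.1 B, (hp n).2.2⟩, ?_, tendsto_const_nhds,
    tendsto_const_nhds⟩
  have : (fun n => (p n).rate) = fun _ => 0 := by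
    funext n
    rw [Protocol.rate, (hp n).1]
    simp
  rw [this]
  exact tendsto_const_nhds

end Achievability

/-! ### Transcripts of the commit phase -/

section Transcript

variable {S N U V X Z : Type*}

/-- The messages which Alice sends in the first `r` rounds when she receives `v`. -/
def aliceMessages (al : AliceStrategy S U V X) (s : S) (v : List V) (r : ℕ) : List U :=
  (List.range r).map fun j => al.send s (v.take j)

/-- The messages which Bob sends in the first `r` rounds when he receives `z` and `u`. -/
def bobMessages (T : Schedule) (n : ℕ) (bo : BobStrategy N U V Z) (ν : N) (z : List Z)
    (u : List U) (r : ℕ) : List V :=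
  (List.range r).map fun j => bo.reply ν (z.take (T.usesBefore n j)) (u.take (j + 1))

/-- The inputs of Alice to the channel when she receives `v`. -/
def aliceInputs (T : Schedule) (n : ℕ) (al : AliceStrategy S U V X) (s : S) (v : List V) :
    Fin n → X :=
  fun i => al.input s i (v.take (T.slot i))

variable (T : Schedule) (n : ℕ) (al : AliceStrategy S U V X) (bo : BobStrategy N U V Z) (s : S)
  (ν : N)

theorem messages_length (z : List Z) (j : ℕ) :
    (messages T n al bo s ν z j).1.length = j ∧ (messages T n al bo s ν z j).2.length = j := by
  induction j with
  | zero => exact ⟨rfl, rfl⟩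
  | succ j ih => simp [messages, ih.1, ih.2]

theorem messages_take (z : List Z) {j r : ℕ} (hj : j ≤ r) :
    (messages T n al bo s ν z r).1.take j = (messages T n al bo s ν z j).1 ∧
    (messages T n al bo s ν z r).2.take j = (messages T n al bo s ν z j).2 := by
  induction r, hj using Nat.le_induction with
  | base =>
    have := messages_length T n al bo s ν z j
    exact ⟨List.take_of_length_le this.1.le, List.take_of_length_le this.2.le⟩
  | succ r hr ih =>
    have := messages_length T n al bo s ν z r
    simp only [messages]
    rw [List.take_append_of_le_length (by omega), List.take_append_of_le_length (by omega)]
    exact ih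

/-- With `messages_eq_of_consistent` this characterises the noiseless messages as the only pair
consistent with each party separately: the rectangle property of communication protocols, which
makes the law of the outcome factorise. -/
theorem messages_eq (z : List Z) (r : ℕ) :
    (messages T n al bo s ν z r).1 = aliceMessages al s (messages T n al bo s ν z r).2 r ∧
    (messages T n al bo s ν z r).2
      = bobMessages T n bo ν z (messages T n al bo s ν z r).1 r := by
  have key : ∀ k ≤ r, (messages T n al bo s ν z k).1
        = aliceMessages al s (messages T n al bo s ν z r).2 k ∧
      (messages T n al bo s ν z k).2
        = bobMessages T n bo ν z (messages T n al bo s ν z r).1 k := by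
    intro k
    induction k with
    | zero => exact fun _ => ⟨rfl, rfl⟩
    | succ k ih =>
      intro hk
      have h1 := ih (by omega)
      have h2 := messages_take T n al bo s ν z (show k ≤ r by omega)
      have h3 := messages_take T n al bo s ν z hk
      unfold aliceMessages bobMessages at h1 ⊢
      rw [List.range_succ, List.map_append, List.map_append, ← h1.1, ← h1.2]
      simp only [List.map_cons, List.map_nil]
      rw [h2.2, h3.1]
      exact ⟨rfl, rfl⟩
  exact key r le_rfl

theorem messages_eq_of_consistent (z : List Z) {r : ℕ} {u : List U} {v : List V}
    (hu : u = aliceMessages al s v r) (hv : v = bobMessages T n bo ν z u r) :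
    messages T n al bo s ν z r = (u, v) := by
  have hul : u.length = r := by rw [hu]; simp [aliceMessages]
  have hvl : v.length = r := by rw [hv]; simp [bobMessages]
  have key : ∀ k ≤ r, messages T n al bo s ν z k = (u.take k, v.take k) := by
    intro k
    induction k with
    | zero => exact fun _ => by simp [messages]
    | succ k ih =>
      intro hk
      have h1 := ih (by omega)
      have hu' : u.take (k + 1) = u.take k ++ [al.send s (v.take k)] := by
        rw [List.take_succ_eq_append_getElem (by omega)]
        congr 2
        simp only [hu, aliceMessages, List.getElem_map, List.getElem_range]
      have hv' : v.take (k + 1)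
          = v.take k ++ [bo.reply ν (z.take (T.usesBefore n k)) (u.take (k + 1))] := by
        rw [List.take_succ_eq_append_getElem (by omega)]
        congr 2
        conv_lhs => simp only [hv]
        simp only [bobMessages, List.getElem_map, List.getElem_range]
      simp only [messages, h1]
      rw [← hu', ← hv']
  have := key r le_rfl
  rwa [List.take_of_length_le hul.le, List.take_of_length_le hvl.le] at this

theorem messages_congr {z z' : List Z} {j : ℕ}
    (h : ∀ k < j, z.take (T.usesBefore n k) = z'.take (T.usesBefore n k)) :
    messages T n al bo s ν z j = messages T n al bo s ν z' j := by
  induction j with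
  | zero => rfl
  | succ j ih =>
    simp only [messages]
    rw [ih fun k hk => h k (by omega), h j (by omega)]

/-- Causality: the round with index `k` (number `k + 1`) is over before use `i` of the channel, so
Bob's reply in it depends only on outputs preceding that use. -/
theorem Schedule.usesBefore_le {k i : ℕ} (h : k < T.slot i) : T.usesBefore n k ≤ i := by
  rw [Schedule.usesBefore, Nat.count_eq_card_filter_range]
  calc ((Finset.range n).filter fun l => T.slot l < k + 1).card ≤ (Finset.range i).card := by
        refine Finset.card_le_card fun l hl => ?_
        rw [Finset.mem_filter] at hl
        rw [Finset.mem_range]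
        by_contra hli
        have := T.slot_mono (not_lt.1 hli)
        omega
    _ = i := Finset.card_range i

theorem take_ofFn_castLE (z : Fin n → Z) {i : ℕ} (hi : i ≤ n) :
    List.ofFn (fun k : Fin i => z (Fin.castLE hi k)) = (List.ofFn z).take i := by
  apply List.ext_getElem
  · simp [hi]
  · intro k h1 h2
    simp

/-- The inputs to the channel are determined by Alice's data and the messages of Bob. -/
theorem input_messages_eq (z : Fin n → Z) (i : Fin n) :
    al.input s i (messages T n al bo s ν
        (List.ofFn fun k : Fin i => z (Fin.castLE i.isLt.le k)) (T.slot i)).2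
      = aliceInputs T n al s (messages T n al bo s ν (List.ofFn z) T.r).2 i := by
  rw [aliceInputs, (messages_take T n al bo s ν (List.ofFn z) (T.slot_le i)).2,
    take_ofFn_castLE n z i.isLt.le, messages_congr T n al bo s ν (z' := List.ofFn z)]
  intro k hk
  rw [List.take_take, min_eq_left (T.usesBefore_le n hk)]

end Transcript

/-! ### Openings computed from the transcript -/

section Decoder

/-- Some value of a function is at least its average. -/
theorem exists_average_le {S : Type*} [Nonempty S] (w q : S → ℝ≥0∞) (hw : ∑' s, w s ≠ ∞)
    (hq : ∀ s, q s ≤ 1) : ∃ s, ∑' t, w t * q t ≤ (∑' t, w t) * q s := by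
  by_contra hcon
  push Not at hcon
  by_cases h0 : ∀ s, w s = 0
  · obtain ⟨s⟩ := ‹Nonempty S›
    simpa [h0] using hcon s
  push Not at h0
  obtain ⟨s₀, hs₀⟩ := h0
  have hfin : ∑' t, w t * q t ≠ ∞ :=
    ne_top_of_le_ne_top hw (ENNReal.tsum_le_tsum fun t => mul_le_of_le_one_right' (hq t))
  -- Averaging the supposed strict inequalities with the weights `w`; both sides equal `(∑' t, w t)
  -- * ∑' t, w t * q t`.
  have hlt : ∑' s, w s * ((∑' t, w t) * q s) < ∑' s, w s * ∑' t, w t * q t := by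
    refine ENNReal.tsum_lt_tsum (i := s₀) ?_ (fun s => by gcongr; exact (hcon s).le) ?_
    · rw [tsum_congr fun s => mul_left_comm _ _ _, ENNReal.tsum_mul_left]
      exact ENNReal.mul_ne_top hw hfin
    · exact ENNReal.mul_lt_mul_right hs₀ (ne_top_of_le_ne_top hw (ENNReal.le_tsum s₀)) (hcon s₀)
  rw [tsum_congr fun s => mul_left_comm _ _ _, ENNReal.tsum_mul_left,
    ENNReal.tsum_mul_right] at hlt
  exact lt_irrefl _ hlt

variable {S N U V X Z : Type*} [Fintype Z] (W : X → PMF Z) (T : Schedule) (n : ℕ) (pS : PMF S)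
  (al : AliceStrategy S U V X) (pN : PMF N) (bo : BobStrategy N U V Z)

/-- The outcome of the commit phase as a function of the private data and the outputs. -/
def outcome (s : S) (ν : N) (z : Fin n → Z) : Outcome S N U V Z n :=
  ⟨s, ν, z, (messages T n al bo s ν (List.ofFn z) T.r).1,
    (messages T n al bo s ν (List.ofFn z) T.r).2⟩

theorem wordLaw_apply {X Z : Type*} [Fintype Z] (W : X → PMF Z) {n : ℕ} (x : Fin n → X)
    (z : Fin n → Z) : wordLaw W x z = ∏ i, W (x i) (z i) := by
  rw [← ENNReal.toReal_eq_toReal_iff' (PMF.apply_ne_top _ _)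
    (ENNReal.prod_ne_top fun i _ => PMF.apply_ne_top _ _), wordLaw_toReal, ENNReal.toReal_prod]

/-- Inputs may depend on earlier outputs through Bob's messages, but the probability of an output
sequence is the memoryless one for the word sent along it. -/
theorem outputLaw_messages (s : S) (ν : N) (z : Fin n → Z) :
    outputLaw W (fun i z => al.input s i
        (messages T n al bo s ν (List.ofFn z) (T.slot i)).2) n z
      = wordLaw W (aliceInputs T n al s (outcome T n al bo s ν z).v) z := by
  rw [wordLaw_apply, outputLaw_apply]
  refine Finset.prod_congr rfl fun i _ => ?_
  rw [input_messages_eq]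
  rfl

open Classical in
theorem commitLaw_toOuterMeasure (E : Outcome S N U V Z n → Prop) :
    (commitLaw W n T pS al pN bo).toOuterMeasure {o | E o}
      = ∑' s, ∑' ν, ∑' z, pS s * (pN ν *
        (wordLaw W (aliceInputs T n al s (outcome T n al bo s ν z).v) z *
          if E (outcome T n al bo s ν z) then 1 else 0)) := by
  unfold commitLaw
  rw [PMF.toOuterMeasure_bind_apply]
  refine tsum_congr fun s => ?_
  rw [PMF.toOuterMeasure_bind_apply, ← ENNReal.tsum_mul_left]
  refine tsum_congr fun ν => ?_
  rw [PMF.toOuterMeasure_map_apply, PMF.toOuterMeasure_apply, ENNReal.tsum_mul_left,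
    ENNReal.tsum_mul_left]
  congr 2
  refine tsum_congr fun z => ?_
  rw [← outputLaw_messages]
  by_cases h : E (outcome T n al bo s ν z)
  · rw [if_pos h, mul_one, Set.indicator_of_mem]
    exact h
  · rw [if_neg h, mul_zero, Set.indicator_of_notMem]
    exact h

theorem mem_support_commitLaw {o : Outcome S N U V Z n}
    (ho : commitLaw W n T pS al pN bo o ≠ 0) :
    o = outcome T n al bo o.alice o.bob o.z ∧
      ∀ i, W (aliceInputs T n al o.alice o.v i) (o.z i) ≠ 0 := by
  unfold commitLaw at ho
  rw [← PMF.mem_support_iff, PMF.mem_support_bind_iff] at ho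
  obtain ⟨s, -, ho⟩ := ho
  rw [PMF.mem_support_bind_iff] at ho
  obtain ⟨ν, -, ho⟩ := ho
  rw [PMF.mem_support_map_iff] at ho
  obtain ⟨z, hz, rfl⟩ := ho
  refine ⟨rfl, fun i h => hz ?_⟩
  rw [outputLaw_messages, wordLaw_apply]
  exact Finset.prod_eq_zero (Finset.mem_univ i) h

/-- What the inputs to the channel and the noiseless messages tell about Alice's data. -/
def transcript (s : S) (u : List U) (v : List V) : (Fin n → X) × List U × List V :=
  (aliceInputs T n al s v, u, v)

open Classical in
/-- Given the transcript, the data of Alice and Bob are independent. -/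
theorem commitLaw_toOuterMeasure_transcript (acc : S → N → (Fin n → Z) → List U → Prop)
    (D : (Fin n → X) × List U × List V → S → S) :
    (commitLaw W n T pS al pN bo).toOuterMeasure
        {o | acc (D (transcript T n al o.alice o.u o.v) o.alice) o.bob o.z o.u}
      = ∑' c : (Fin n → X) × List U × List V, ∑' s,
        (if c.1 = aliceInputs T n al s c.2.2 ∧ c.2.1 = aliceMessages al s c.2.2 T.r
          then pS s else 0) *
        ∑' ν, ∑' z, (if c.2.2 = bobMessages T n bo ν (List.ofFn z) c.2.1 T.r
          then pN ν * (wordLaw W c.1 z * if acc (D c s) ν z c.2.1 then 1 else 0) else 0) := by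
  rw [commitLaw_toOuterMeasure]
  simp_rw [← ENNReal.tsum_mul_left]
  conv_rhs => rw [ENNReal.tsum_comm]
  refine tsum_congr fun s => ?_
  conv_rhs => rw [ENNReal.tsum_comm]
  refine tsum_congr fun ν => ?_
  conv_rhs => rw [ENNReal.tsum_comm]
  refine tsum_congr fun z => ?_
  -- For fixed `s`, `ν`, `z` only the actual transcript passes both consistency conditions, so each
  -- outcome is counted once.
  rw [tsum_eq_single (transcript T n al s (outcome T n al bo s ν z).u
    (outcome T n al bo s ν z).v)]
  · have h := messages_eq T n al bo s ν (List.ofFn z) T.r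
    exact (congrArg₂ (· * ·) (if_pos ⟨rfl, h.1⟩) (if_pos h.2)).symm
  · rintro ⟨x, u, v⟩ hc
    by_cases h1 : x = aliceInputs T n al s v ∧ u = aliceMessages al s v T.r
    · by_cases h2 : v = bobMessages T n bo ν (List.ofFn z) u T.r
      · exfalso
        apply hc
        have := messages_eq_of_consistent T n al bo s ν (List.ofFn z) h1.2 h2
        simp only [outcome, transcript, this, h1.1]
      · simp [h2]
    · simp [h1]

/-- Data computed from the transcript alone are accepted at least as often as the data of
Alice. -/
theorem exists_decoder (acc : S → N → (Fin n → Z) → List U → Prop) :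
    ∃ d : (Fin n → X) × List U × List V → S,
      prob (commitLaw W n T pS al pN bo) (fun o => acc o.alice o.bob o.z o.u)
        ≤ prob (commitLaw W n T pS al pN bo)
          fun o => acc (d (transcript T n al o.alice o.u o.v)) o.bob o.z o.u := by
  classical
  have : Nonempty S := ⟨pS.support_nonempty.choose⟩
  -- For a fixed transcript the first factor weighs Alice's data and the second, which depends on
  -- `s` only through `acc`, is what those data gain from acceptance. Some fixed data do at least as
  -- well as the average.
  have hex := fun c : (Fin n → X) × List U × List V => exists_average_le
    (fun s => if c.1 = aliceInputs T n al s c.2.2 ∧ c.2.1 = aliceMessages al s c.2.2 T.r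
      then pS s else 0)
    (fun s => ∑' ν, ∑' z, (if c.2.2 = bobMessages T n bo ν (List.ofFn z) c.2.1 T.r
      then pN ν * (wordLaw W c.1 z * if acc s ν z c.2.1 then 1 else 0) else 0))
    (by
      refine ne_top_of_le_ne_top pS.tsum_coe_ne_top (ENNReal.tsum_le_tsum fun s => ?_)
      split_ifs
      · exact le_rfl
      · exact zero_le)
    (by
      intro s
      calc _ ≤ ∑' ν, ∑' z, pN ν * wordLaw W c.1 z := by
            refine ENNReal.tsum_le_tsum fun ν => ENNReal.tsum_le_tsum fun z => ?_
            split_ifs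
            · rw [mul_one]
            · simp
            · exact zero_le
        _ = 1 := by
            simp_rw [ENNReal.tsum_mul_left, PMF.tsum_coe, mul_one]
            exact pN.tsum_coe)
  choose d hd using hex
  refine ⟨d, ENNReal.toReal_mono
    (ne_top_of_le_ne_top ENNReal.one_ne_top (toOuterMeasure_le_one _ _)) ?_⟩
  rw [commitLaw_toOuterMeasure_transcript W T n pS al pN bo acc (fun _ s => s),
    commitLaw_toOuterMeasure_transcript W T n pS al pN bo acc (fun c _ => d c)]
  refine ENNReal.tsum_le_tsum fun c => ?_
  rw [ENNReal.tsum_mul_right]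
  exact hd c

end Decoder

/-! ### Single-letter marginals and Markov's inequality -/

section Marginal

variable {X Z : Type*}

theorem outputLaw_map_castLE (W : X → PMF Z) (x : (i : ℕ) → (Fin i → Z) → X) {k n : ℕ}
    (h : k ≤ n) : (outputLaw W x n).map (fun z j => z (Fin.castLE h j)) = outputLaw W x k := by
  induction n, h using Nat.le_induction with
  | base => exact PMF.map_id _
  | succ n h ih =>
    rw [outputLaw, PMF.map_bind, ← ih]
    rw [PMF.map]
    refine congrArg _ (funext fun z => ?_)
    rw [PMF.map_comp]
    have : ((fun z' : Fin (n + 1) → Z => fun j => z' (Fin.castLE (h.trans n.le_succ) j)) ∘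
        fun y => (Fin.snoc z y : Fin (n + 1) → Z)) = fun _ j => z (Fin.castLE h j) := by
      funext y j
      have : Fin.castLE (h.trans n.le_succ) j = (Fin.castLE h j).castSucc := rfl
      simp only [Function.comp_apply]
      rw [this, Fin.snoc_castSucc]
    exact (congrArg (fun f => PMF.map f _) this).trans (PMF.map_const _ _)

/-- The first `i + 1` outputs do not depend on later uses, and the last of them is drawn from `W` at
the input computed from the others. The inputs may be dependent: the converse needs only these
single-letter marginals. -/
theorem outputLaw_map_pair (W : X → PMF Z) (x : (i : ℕ) → (Fin i → Z) → X) {n : ℕ} (i : Fin n) :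
    (outputLaw W x n).map (fun z => (x i fun k => z (Fin.castLE i.isLt.le k), z i))
      = jointLaw W ((outputLaw W x n).map fun z => x i fun k => z (Fin.castLE i.isLt.le k)) := by
  have h1 := outputLaw_map_castLE W x (Nat.succ_le_of_lt i.isLt)
  have h2 := outputLaw_map_castLE W x i.isLt.le
  have e1 : (outputLaw W x n).map (fun z => (x i fun k => z (Fin.castLE i.isLt.le k), z i))
      = (outputLaw W x (i + 1)).map
        fun z => (x i fun k => z (Fin.castSucc k), z (Fin.last i)) := by
    rw [← h1, PMF.map_comp]
    rfl
  have e2 : ((outputLaw W x n).map fun z => x i fun k => z (Fin.castLE i.isLt.le k))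
      = (outputLaw W x i).map (x i) := by
    rw [← h2, PMF.map_comp]
    rfl
  rw [e1, e2, outputLaw, PMF.map_bind, jointLaw, PMF.bind_map]
  refine congrArg _ (funext fun z => ?_)
  rw [PMF.map_comp]
  refine congrArg (fun f => PMF.map f _) (funext fun y => ?_)
  simp

variable {S N U V : Type*}

/-- In the commit phase each output of the channel depends on the input only. -/
theorem commitLaw_map_pair (W : X → PMF Z) (T : Schedule) (n : ℕ) (pS : PMF S)
    (al : AliceStrategy S U V X) (pN : PMF N) (bo : BobStrategy N U V Z) (i : Fin n) :
    (commitLaw W n T pS al pN bo).map (fun o => (aliceInputs T n al o.alice o.v i, o.z i))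
      = jointLaw W ((commitLaw W n T pS al pN bo).map
        fun o => aliceInputs T n al o.alice o.v i) := by
  unfold commitLaw
  rw [PMF.map_bind, PMF.map_bind, jointLaw, PMF.bind_bind]
  refine congrArg _ (funext fun s => ?_)
  rw [PMF.map_bind, PMF.map_bind, PMF.bind_bind]
  refine congrArg _ (funext fun ν => ?_)
  rw [PMF.map_comp, PMF.map_comp]
  have h := outputLaw_map_pair W (fun i z => al.input s i
    (messages T n al bo s ν (List.ofFn z) (T.slot i)).2) i
  simp only [input_messages_eq] at h
  exact h

theorem sum_map_toReal_mul {α β : Type*} [Fintype α] [Fintype β] (p : PMF α) (f : α → β)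
    (g : β → ℝ) : ∑ b, (p.map f b).toReal * g b = ∑ a, (p a).toReal * g (f a) := by
  classical
  simp_rw [PMF.map, bind_toReal, Finset.sum_mul]
  rw [Finset.sum_comm]
  refine Finset.sum_congr rfl fun a _ => ?_
  rw [Finset.sum_eq_single (f a)]
  · simp
  · intro b _ hb
    simp [hb]
  · simp

/-- Markov's inequality for the sum of the negative logarithms of the backward probabilities. -/
theorem prob_le_sum_neg_logb_backward [Fintype X] [Fintype Z] {W : X → PMF Z} {n : ℕ}
    (J : PMF (Fin n → X × Z)) (P : Fin n → PMF X)
    (hJ : ∀ i, J.map (fun c => c i) = jointLaw W (P i)) {C t : ℝ} (ht : 0 < t)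
    (hC : ∀ P, equivocation W P ≤ C) :
    prob J (fun c => t ≤ ∑ i, - Real.logb 2 (backward W (P i) (c i).1 (c i).2)) ≤ n * C / t := by
  classical
  set g : (i : Fin n) → X × Z → ℝ := fun i c => - Real.logb 2 (backward W (P i) c.1 c.2) with hg
  have hg0 : ∀ i c, 0 ≤ g i c := fun i c => neg_nonneg.2
    (Real.logb_nonpos one_lt_two (backward_nonneg _ _ _ _) (backward_le_one _ _ _ _))
  rw [prob_fintype, le_div_iff₀ ht, Finset.sum_mul]
  calc ∑ c : Fin n → X × Z, (if t ≤ ∑ i, g i (c i) then (J c).toReal else 0) * t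
      ≤ ∑ c : Fin n → X × Z, (J c).toReal * ∑ i, g i (c i) := by
        refine Finset.sum_le_sum fun c _ => ?_
        split_ifs with h
        · exact mul_le_mul_of_nonneg_left h ENNReal.toReal_nonneg
        · rw [zero_mul]
          exact mul_nonneg ENNReal.toReal_nonneg (Finset.sum_nonneg fun i _ => hg0 i _)
    _ = ∑ i, equivocation W (P i) := by
        simp_rw [Finset.mul_sum]
        rw [Finset.sum_comm]
        refine Finset.sum_congr rfl fun i _ => ?_
        rw [← sum_map_toReal_mul J (fun c => c i) (g i), hJ, equivocation_eq,
          Fintype.sum_prod_type]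
        simp_rw [jointLaw_toReal]
        rfl
    _ ≤ ∑ _i : Fin n, C := Finset.sum_le_sum fun i _ => hC _
    _ = n * C := by simp

theorem two_rpow_neg_le_prod_backward [Fintype X] {W : X → PMF Z} {n : ℕ} {P : Fin n → PMF X}
    {c : Fin n → X × Z} {t : ℝ} (hpos : ∀ i, 0 < backward W (P i) (c i).1 (c i).2)
    (h : ∑ i, - Real.logb 2 (backward W (P i) (c i).1 (c i).2) ≤ t) :
    (2 : ℝ) ^ (-t) ≤ ∏ i, backward W (P i) (c i).1 (c i).2 := by
  have h1 : ∀ i, backward W (P i) (c i).1 (c i).2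
      = (2 : ℝ) ^ (Real.logb 2 (backward W (P i) (c i).1 (c i).2)) := fun i => by
    rw [Real.rpow_logb two_pos (by norm_num) (hpos i)]
  rw [Finset.prod_congr rfl fun i _ => h1 i, ← Real.rpow_sum_of_pos two_pos]
  refine Real.rpow_le_rpow_of_exponent_le one_le_two ?_
  rw [Finset.sum_neg_distrib] at h
  linarith

end Marginal

/-! ### Probabilities of several events -/

section ProbMore

variable {α β : Type*}

theorem prob_mono_of_support (p : PMF α) {E F : α → Prop} (h : ∀ a, p a ≠ 0 → E a → F a) :
    prob p E ≤ prob p F := by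
  refine ENNReal.toReal_mono (ne_top_of_le_ne_top ENNReal.one_ne_top (toOuterMeasure_le_one p _)) ?_
  refine PMF.toOuterMeasure_mono p ?_
  rintro a ⟨ha, hs⟩
  exact h a hs ha

theorem prob_or_le (p : PMF α) (E F : α → Prop) :
    prob p (fun a => E a ∨ F a) ≤ prob p E + prob p F := by
  have hne : ∀ s, p.toOuterMeasure s ≠ ∞ := fun s =>
    ne_top_of_le_ne_top ENNReal.one_ne_top (toOuterMeasure_le_one p s)
  rw [prob, prob, prob, ← ENNReal.toReal_add (hne _) (hne _)]
  exact ENNReal.toReal_mono (ENNReal.add_ne_top.2 ⟨hne _, hne _⟩)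
    (MeasureTheory.measure_union_le (μ := p.toOuterMeasure) _ _)

theorem prob_bind_fintype [Fintype α] (p : PMF α) (f : α → PMF β) (E : β → Prop) :
    prob (p.bind f) E = ∑ a, (p a).toReal * prob (f a) E := by
  rw [prob, PMF.toOuterMeasure_bind_apply, tsum_fintype, ENNReal.toReal_sum]
  · exact Finset.sum_congr rfl fun a _ => ENNReal.toReal_mul
  · exact fun a _ => ENNReal.mul_ne_top (p.apply_ne_top a)
      (ne_top_of_le_ne_top ENNReal.one_ne_top (toOuterMeasure_le_one _ _))

open Classical in
theorem prob_eq_tsum (p : PMF α) (E : α → Prop) :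
    prob p E = ∑' a, if E a then (p a).toReal else 0 := by
  rw [prob, PMF.toOuterMeasure_apply, ENNReal.tsum_toReal_eq]
  · refine tsum_congr fun a => ?_
    by_cases h : E a <;> simp [Set.indicator, h]
  · intro a
    exact ne_top_of_le_ne_top (p.apply_ne_top a) (Set.indicator_le_self' (fun _ _ => zero_le) a)

theorem summable_toReal (p : PMF α) : Summable fun a => (p a).toReal :=
  ENNReal.summable_toReal p.tsum_coe_ne_top

/-- The event and its complement contribute the same difference with opposite signs, so the sum of
absolute values is at least twice that difference; this matches the factor `1 / 2`. -/
theorem prob_le_add_tvDist (p q : PMF α) (E : α → Prop) : prob p E ≤ prob q E + tvDist p q := by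
  classical
  have hs : ∀ (p : PMF α) (E : α → Prop), Summable fun a => if E a then (p a).toReal else 0 := by
    intro p E
    refine Summable.of_nonneg_of_le (fun a => ?_) (fun a => ?_) (summable_toReal p)
    · split_ifs
      · exact ENNReal.toReal_nonneg
      · exact le_rfl
    · split_ifs
      · exact le_rfl
      · exact ENNReal.toReal_nonneg
  have h1 : (prob p E - prob q E) - (prob p (fun a => ¬ E a) - prob q fun a => ¬ E a)
      ≤ ∑' a, |(p a).toReal - (q a).toReal| := by
    rw [prob_eq_tsum, prob_eq_tsum, prob_eq_tsum, prob_eq_tsum, ← (hs p E).tsum_sub (hs q E),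
      ← (hs p fun a => ¬ E a).tsum_sub (hs q fun a => ¬ E a),
      ← ((hs p E).sub (hs q E)).tsum_sub ((hs p fun a => ¬ E a).sub (hs q fun a => ¬ E a))]
    refine Summable.tsum_le_tsum (fun a => ?_)
      (((hs p E).sub (hs q E)).sub ((hs p fun a => ¬ E a).sub (hs q fun a => ¬ E a)))
      ((summable_toReal p).sub (summable_toReal q)).abs
    by_cases h : E a
    · simp only [h, if_true, not_true, if_false, sub_zero]
      exact le_abs_self _
    · simp only [h, if_false, not_false_eq_true, if_true, sub_self, zero_sub]
      exact neg_le_abs _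
  rw [prob_not, prob_not] at h1
  rw [tvDist]
  linarith

/-- If at most `c` of the events occur at the same time, then the sum of their probabilities is at
most `c`. -/
theorem sum_prob_le {ι : Type*} [Fintype ι] (p : PMF α) (E : ι → α → Prop)
    [∀ i a, Decidable (E i a)] {c : ℝ}
    (h : ∀ a, ∑ i, (if E i a then (1 : ℝ) else 0) ≤ c) : ∑ i, prob p (E i) ≤ c := by
  classical
  have hs : ∀ i, Summable fun a => if E i a then (p a).toReal else 0 := by
    intro i
    refine Summable.of_nonneg_of_le (fun a => ?_) (fun a => ?_) (summable_toReal p)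
    · split_ifs
      · exact ENNReal.toReal_nonneg
      · exact le_rfl
    · split_ifs
      · exact le_rfl
      · exact ENNReal.toReal_nonneg
  have h1 : ∀ i, prob p (E i) = ∑' a, if E i a then (p a).toReal else 0 := by
    intro i
    rw [prob_eq_tsum]
    exact tsum_congr fun a => by congr
  simp_rw [h1]
  rw [← Summable.tsum_finsetSum fun i _ => hs i]
  have hone : ∑' a, (p a).toReal = 1 := by
    rw [← ENNReal.tsum_toReal_eq fun b => p.apply_ne_top b, p.tsum_coe, ENNReal.toReal_one]
  calc ∑' a, ∑ i, (if E i a then (p a).toReal else 0) ≤ ∑' a, (p a).toReal * c := by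
        refine Summable.tsum_le_tsum (fun a => ?_) (summable_sum fun i _ => hs i)
          ((summable_toReal p).mul_right c)
        have : ∑ i, (if E i a then (p a).toReal else 0)
            = (p a).toReal * ∑ i, (if E i a then (1 : ℝ) else 0) := by
          rw [Finset.mul_sum]
          exact Finset.sum_congr rfl fun i _ => by rw [mul_ite, mul_one, mul_zero]
        rw [this]
        exact mul_le_mul_of_nonneg_left (h a) ENNReal.toReal_nonneg
    _ = c := by rw [tsum_mul_right, hone, one_mul]

end ProbMore

/-! ### The converse -/

section Converse

theorem messages_congr_alice {S S' N U V X Z : Type*} (T : Schedule) (n : ℕ)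
    {al : AliceStrategy S U V X} {al' : AliceStrategy S' U V X} (bo : BobStrategy N U V Z)
    {s : S} {s' : S'} (h : ∀ v, al.send s v = al'.send s' v) (ν : N) (z : List Z) (j : ℕ) :
    messages T n al bo s ν z j = messages T n al' bo s' ν z j := by
  induction j with
  | zero => rfl
  | succ j ih => simp only [messages, ih, h]

variable {X Z : Type*} {n : ℕ} (p : Protocol X Z n)

/-- Honest Alice when her message is a part of her private data. -/
def Protocol.mixedAlice : AliceStrategy (p.Msg × p.M) p.U p.V X where
  send s v := (p.alice s.1).send s.2 v
  input s i v := (p.alice s.1).input s.2 i v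

/-- An honest Alice with a random message is one particular strategy with private data in `Msg × M`,
so the condition against double opening applies to her. -/
theorem Protocol.commitLaw_mixedAlice (W : X → PMF Z) (pA : PMF p.Msg) :
    commitLaw W n p.sched (pA.bind fun a => p.pM.map fun m => (a, m)) p.mixedAlice p.pN p.bob
      = pA.bind fun a => (commitLaw W n p.sched p.pM (p.alice a) p.pN p.bob).map
        fun o => ⟨(a, o.alice), o.bob, o.z, o.u, o.v⟩ := by
  unfold commitLaw
  rw [PMF.bind_bind]
  refine congrArg _ (funext fun a => ?_)
  rw [PMF.bind_map, PMF.map_bind]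
  refine congrArg _ (funext fun m => ?_)
  rw [PMF.map_bind]
  refine congrArg _ (funext fun ν => ?_)
  rw [PMF.map_comp]
  have h : ∀ z j, messages p.sched n p.mixedAlice p.bob (a, m) ν z j
      = messages p.sched n (p.alice a) p.bob m ν z j := fun z j =>
    messages_congr_alice p.sched n (al := p.mixedAlice) (al' := p.alice a) p.bob (s := (a, m))
      (s' := m) (fun _ => rfl) ν z j
  simp only [h]
  rfl

/-- In a binding protocol the message of honest Alice is determined by the transcript, up to a
small probability of error. -/
theorem Protocol.exists_message_decoder [Fintype Z] {W : X → PMF Z} {δ : ℝ}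
    (hbind : p.Binding W δ) [Nontrivial p.Msg] [Fintype p.Msg] (pA : PMF p.Msg) :
    ∃ d : (Fin n → X) × List p.U × List p.V → p.Msg,
      prob (commitLaw W n p.sched (pA.bind fun a => p.pM.map fun m => (a, m)) p.mixedAlice p.pN
        p.bob) (fun o => d (transcript p.sched n p.mixedAlice o.alice o.u o.v) ≠ o.alice.1)
        ≤ 3 * δ := by
  classical
  set L := commitLaw W n p.sched (pA.bind fun a => p.pM.map fun m => (a, m)) p.mixedAlice p.pN
    p.bob with hL
  obtain ⟨hsound, hdouble⟩ := hbind
  have hδ0 : 0 ≤ δ := by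
    have := (hsound (Classical.arbitrary _)).trans (prob_le_one _ _)
    linarith
  have hacc : prob L (fun o => ¬ p.test o.z o.bob o.u o.alice.1 o.alice.2) ≤ δ := by
    rw [hL, p.commitLaw_mixedAlice]
    refine prob_bind_le _ _ _ hδ0 fun a _ => ?_
    rw [prob_map, prob_not]
    linarith [hsound a]
  obtain ⟨d, hd⟩ := exists_decoder W p.sched n (pA.bind fun a => p.pM.map fun m => (a, m))
    p.mixedAlice p.pN p.bob (fun s ν z u => p.test z ν u s.1 s.2)
  rw [← hL] at hd
  have hdec : prob L (fun o => ¬ p.test o.z o.bob o.u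
      (d (transcript p.sched n p.mixedAlice o.alice o.u o.v)).1
      (d (transcript p.sched n p.mixedAlice o.alice o.u o.v)).2) ≤ δ := by
    rw [prob_not] at hacc ⊢
    linarith
  -- Claims may depend only on Alice's data and Bob's messages; her own messages are recomputed from
  -- these.
  let D : p.Msg × p.M → List p.V → p.Msg × p.M := fun s v =>
    d (transcript p.sched n p.mixedAlice s (aliceMessages p.mixedAlice s v p.sched.r) v)
  choose other hother using fun a : p.Msg => exists_ne a
  -- The two claims are the honest opening and the decoded one. Where the decoder is right, another
  -- message is substituted, so that the claims always differ.
  have h := hdouble (p.Msg × p.M) (pA.bind fun a => p.pM.map fun m => (a, m)) p.mixedAlice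
    (fun s _ => s.1) (fun s v => if (D s v).1 ≠ s.1 then (D s v).1 else other s.1)
    (fun s _ => s.2) (fun s v => (D s v).2) (by
      rw [prob_eq_one_iff]
      intro o _
      split_ifs with h
      · exact h.symm
      · exact (hother _).symm)
  rw [← hL] at h
  refine ⟨fun c => (d c).1, ?_⟩
  refine (prob_mono_of_support L (F := fun o => ((p.test o.z o.bob o.u o.alice.1 o.alice.2 ∧
      p.test o.z o.bob o.u
        (if (D o.alice o.v).1 ≠ o.alice.1 then (D o.alice o.v).1 else other o.alice.1)
        (D o.alice o.v).2) ∨ ¬ p.test o.z o.bob o.u o.alice.1 o.alice.2) ∨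
      ¬ p.test o.z o.bob o.u (d (transcript p.sched n p.mixedAlice o.alice o.u o.v)).1
        (d (transcript p.sched n p.mixedAlice o.alice o.u o.v)).2) ?_).trans ?_
  · intro o ho hne
    have hu : o.u = aliceMessages p.mixedAlice o.alice o.v p.sched.r := by
      have h1 := (mem_support_commitLaw W p.sched n _ _ _ _ ho).1
      have h2 := messages_eq p.sched n p.mixedAlice p.bob o.alice o.bob (List.ofFn o.z) p.sched.r
      have h3 : o.u = (messages p.sched n p.mixedAlice p.bob o.alice o.bob (List.ofFn o.z)
        p.sched.r).1 := congrArg Outcome.u h1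
      have h4 : o.v = (messages p.sched n p.mixedAlice p.bob o.alice o.bob (List.ofFn o.z)
        p.sched.r).2 := congrArg Outcome.v h1
      rw [h3, h4]
      exact h2.1
    have hDd : D o.alice o.v = d (transcript p.sched n p.mixedAlice o.alice o.u o.v) := by
      simp only [D, ← hu]
    rw [hDd, if_pos hne]
    tauto
  · refine (prob_or_le _ _ _).trans ?_
    have := prob_or_le L (fun o => p.test o.z o.bob o.u o.alice.1 o.alice.2 ∧
      p.test o.z o.bob o.u
        (if (D o.alice o.v).1 ≠ o.alice.1 then (D o.alice o.v).1 else other o.alice.1)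
        (D o.alice o.v).2) (fun o => ¬ p.test o.z o.bob o.u o.alice.1 o.alice.2)
    linarith

/-- A bound for the number of messages of a concealing and binding protocol. -/
theorem Protocol.card_bound [Fintype X] [Fintype Z] {W : X → PMF Z} {ε δ C t : ℝ}
    (hconc : p.Concealing W ε) (hbind : p.Binding W δ) (hC : ∀ P, equivocation W P ≤ C)
    (ht : 0 < t) (hcard : 2 ≤ Nat.card p.Msg) :
    1 - 3 * δ - ε - n * C / t ≤ (2 : ℝ) ^ t / Nat.card p.Msg := by
  classical
  have := p.msg_finite
  have := p.msg_nonempty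
  have : Nontrivial p.Msg := Finite.one_lt_card_iff_nontrivial.1 hcard
  let _ : Fintype p.Msg := Fintype.ofFinite _
  set pA : PMF p.Msg := PMF.uniformOfFintype p.Msg with hpA
  obtain ⟨d, hd⟩ := p.exists_message_decoder hbind pA
  set L := commitLaw W n p.sched (pA.bind fun a => p.pM.map fun m => (a, m)) p.mixedAlice p.pN
    p.bob with hL
  set P : Fin n → PMF X := fun i => L.map fun o => aliceInputs p.sched n p.mixedAlice o.alice o.v i
    with hP
  have hmarkov : prob L (fun o => t ≤ ∑ i, - Real.logb 2 (backward W (P i)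
      (aliceInputs p.sched n p.mixedAlice o.alice o.v i) (o.z i))) ≤ n * C / t := by
    have := prob_le_sum_neg_logb_backward (W := W)
      (L.map fun o i => (aliceInputs p.sched n p.mixedAlice o.alice o.v i, o.z i)) P
      (fun i => by
        rw [PMF.map_comp]
        exact commitLaw_map_pair W p.sched n _ p.mixedAlice p.pN p.bob i) ht hC
    rwa [prob_map] at this
  -- The backward weight of all input words that would be decoded as `a`. It is a function of Bob's
  -- view, since his own messages can be recomputed from it.
  let r : p.Msg → (Fin n → Z) × p.N × List p.U → ℝ := fun a y =>
    ∑ x : Fin n → X, if d (x, y.2.2,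
      bobMessages p.sched n p.bob y.2.1 (List.ofFn y.1) y.2.2 p.sched.r) = a
      then ∏ i, backward W (P i) (x i) (y.1 i) else 0
  have hprod0 : ∀ (x : Fin n → X) (z : Fin n → Z), 0 ≤ ∏ i, backward W (P i) (x i) (z i) :=
    fun x z => Finset.prod_nonneg fun i _ => backward_nonneg _ _ _ _
  have hr : ∀ y, ∑ a, r a y ≤ 1 := by
    intro y
    simp only [r]
    rw [Finset.sum_comm]
    simp only [Finset.sum_ite_eq, Finset.mem_univ, if_true]
    rw [sum_prod_eq_prod_sum fun i x => backward W (P i) x (y.1 i)]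
    exact Finset.prod_le_one (fun i _ => Finset.sum_nonneg fun x _ => backward_nonneg _ _ _ _)
      fun i _ => sum_backward_le_one _ _ _
  have hr0 : ∀ a y, 0 ≤ r a y := by
    intro a y
    refine Finset.sum_nonneg fun x _ => ?_
    split_ifs
    · exact hprod0 _ _
    · exact le_rfl
  have h1 : 1 - 3 * δ - n * C / t
      ≤ prob L fun o => (2 : ℝ) ^ (-t) ≤ r o.alice.1 (o.z, o.bob, o.u) := by
    have hor := (prob_or_le L _ _).trans (add_le_add hd hmarkov)
    have hcompl : prob L (fun o => ¬ (2 : ℝ) ^ (-t) ≤ r o.alice.1 (o.z, o.bob, o.u))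
        ≤ 3 * δ + n * C / t := by
      refine (prob_mono_of_support L fun o ho hlt => ?_).trans hor
      by_contra hcon
      push Not at hcon
      obtain ⟨hdo, hsum⟩ := hcon
      apply hlt
      obtain ⟨hout, hW⟩ := mem_support_commitLaw W p.sched n _ _ _ _ ho
      have hv : o.v = bobMessages p.sched n p.bob o.bob (List.ofFn o.z) o.u p.sched.r := by
        have h2 := messages_eq p.sched n p.mixedAlice p.bob o.alice o.bob (List.ofFn o.z)
          p.sched.r
        have h3 : o.u = (messages p.sched n p.mixedAlice p.bob o.alice o.bob (List.ofFn o.z)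
          p.sched.r).1 := congrArg Outcome.u hout
        have h4 : o.v = (messages p.sched n p.mixedAlice p.bob o.alice o.bob (List.ofFn o.z)
          p.sched.r).2 := congrArg Outcome.v hout
        rw [h3, h4]
        exact h2.2
      -- Positivity comes from the outcome having positive probability; `Real.logb 2 0 = 0` would
      -- otherwise spoil the estimate. The true input word alone already contributes `2 ^ (-t)` to
      -- the score.
      have hback := two_rpow_neg_le_prod_backward (W := W) (P := P)
        (c := fun i => (aliceInputs p.sched n p.mixedAlice o.alice o.v i, o.z i)) (t := t)
        (fun i => backward_pos (by
          rw [hP, ← PMF.mem_support_iff, PMF.mem_support_map_iff]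
          exact ⟨o, ho, rfl⟩) (hW i)) hsum.le
      refine hback.trans ?_
      refine le_of_eq_of_le ?_ (Finset.single_le_sum
        (f := fun x : Fin n → X => if d (x, o.u,
          bobMessages p.sched n p.bob o.bob (List.ofFn o.z) o.u p.sched.r) = o.alice.1
          then ∏ i, backward W (P i) (x i) (o.z i) else 0) (fun x _ => ?_)
        (Finset.mem_univ (aliceInputs p.sched n p.mixedAlice o.alice o.v)))
      · dsimp only
        rw [if_pos]
        rw [← hv]
        exact hdo
      · split_ifs
        · exact hprod0 _ _
        · exact le_rfl
    rw [prob_not] at hcompl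
    linarith
  set K := Nat.card p.Msg with hK
  have hKpos : (0 : ℝ) < K := by positivity
  have h2 : (prob L fun o => (2 : ℝ) ^ (-t) ≤ r o.alice.1 (o.z, o.bob, o.u))
      = ∑ a, (K : ℝ)⁻¹ * prob (p.viewLaw W a p.pN p.bob) fun y => (2 : ℝ) ^ (-t) ≤ r a y := by
    rw [hL, p.commitLaw_mixedAlice, prob_bind_fintype]
    refine Finset.sum_congr rfl fun a _ => ?_
    rw [prob_map, Protocol.viewLaw, prob_map, hpA, PMF.uniformOfFintype_apply, hK,
      Nat.card_eq_fintype_card]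
    simp
  obtain ⟨a₀⟩ := p.msg_nonempty
  have h3 : ∀ a, prob (p.viewLaw W a p.pN p.bob) (fun y => (2 : ℝ) ^ (-t) ≤ r a y)
      ≤ prob (p.viewLaw W a₀ p.pN p.bob) (fun y => (2 : ℝ) ^ (-t) ≤ r a y) + ε := fun a =>
    (prob_le_add_tvDist _ _ _).trans (add_le_add le_rfl (hconc p.N p.pN p.bob a a₀))
  -- Under one common law of the view: the scores add up to at most `1`, so at most `2 ^ t` messages
  -- reach `2 ^ (-t)`.
  have h4 : ∑ a, prob (p.viewLaw W a₀ p.pN p.bob) (fun y => (2 : ℝ) ^ (-t) ≤ r a y)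
      ≤ (2 : ℝ) ^ t := by
    refine sum_prob_le _ _ fun y => ?_
    calc ∑ a, (if (2 : ℝ) ^ (-t) ≤ r a y then (1 : ℝ) else 0) ≤ ∑ a, (2 : ℝ) ^ t * r a y := by
          refine Finset.sum_le_sum fun a _ => ?_
          split_ifs with h
          · calc (1 : ℝ) = (2 : ℝ) ^ t * (2 : ℝ) ^ (-t) := by
                  rw [← Real.rpow_add two_pos, add_neg_cancel, Real.rpow_zero]
              _ ≤ _ := by gcongr
          · exact mul_nonneg (by positivity) (hr0 _ _)
      _ ≤ (2 : ℝ) ^ t := by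
          rw [← Finset.mul_sum]
          exact mul_le_of_le_one_right (by positivity) (hr y)
  have h5 : ∑ a, (K : ℝ)⁻¹ * prob (p.viewLaw W a p.pN p.bob) (fun y => (2 : ℝ) ^ (-t) ≤ r a y)
      ≤ (2 : ℝ) ^ t / K + ε := by
    rw [← Finset.mul_sum]
    calc (K : ℝ)⁻¹ * ∑ a, prob (p.viewLaw W a p.pN p.bob) (fun y => (2 : ℝ) ^ (-t) ≤ r a y)
        ≤ (K : ℝ)⁻¹ * ((2 : ℝ) ^ t + K * ε) := by
          refine mul_le_mul_of_nonneg_left ?_ (by positivity)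
          refine (Finset.sum_le_sum fun a _ => h3 a).trans ?_
          rw [Finset.sum_add_distrib, Finset.sum_const, nsmul_eq_mul, Finset.card_univ,
            ← Nat.card_eq_fintype_card]
          exact add_le_add h4 le_rfl
      _ = (2 : ℝ) ^ t / K + ε := by
          field_simp
  linarith

/-- No rate above all equivocations is achievable. -/
theorem Achievable.le_of_equivocation_le [Fintype X] [Fintype Z] {W : X → PMF Z} {B : ℝ≥0∞}
    {R C : ℝ} (hR : Achievable W B R) (hC0 : 0 ≤ C) (hC : ∀ P, equivocation W P ≤ C) :
    R ≤ C := by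
  obtain ⟨p, ε, δ, hp, hrate, hε, hδ⟩ := hR
  refine le_of_forall_pos_le_add fun γ hγ => ?_
  -- `κ = 1 - C / (C + γ)` is what Markov's inequality leaves for `t = n (C + γ)`. It does not tend
  -- to `1`, but any positive constant suffices, since it enters the rate only through `logb 2 (2 /
  -- κ) / n`.
  set κ := γ / (C + γ) with hκ
  have hκpos : 0 < κ := by positivity
  have hlim : Filter.Tendsto (fun n => 1 - 3 * δ n - ε n - C / (C + γ)) Filter.atTop
      (𝓝 (1 - 3 * 0 - 0 - C / (C + γ))) :=
    ((tendsto_const_nhds.sub (hδ.const_mul 3)).sub hε).sub tendsto_const_nhds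
  have hval : 1 - 3 * 0 - 0 - C / (C + γ) = κ := by
    rw [hκ]
    field_simp
    ring
  rw [hval] at hlim
  have hev := hlim.eventually (lt_mem_nhds (half_lt_self hκpos))
  have hup : Filter.Tendsto (fun n : ℕ => C + γ + |Real.logb 2 (2 / κ)| / n) Filter.atTop
      (𝓝 (C + γ)) := by
    simpa using tendsto_const_nhds.add
      (tendsto_const_div_atTop_nhds_zero_nat |Real.logb 2 (2 / κ)|)
  refine le_of_tendsto_of_tendsto hrate hup ?_
  filter_upwards [hev, Filter.eventually_gt_atTop 0] with n hn hnpos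
  have hn' : (0 : ℝ) < n := by positivity
  have := (p n).msg_finite
  have := (p n).msg_nonempty
  have hKpos : 0 < Nat.card (p n).Msg := Nat.card_pos
  -- The decoder argument needs two different messages; a single one has rate `0`.
  rcases Nat.lt_or_ge (Nat.card (p n).Msg) 2 with h2 | h2
  · have h1 : Nat.card (p n).Msg = 1 := by omega
    rw [Protocol.rate, h1]
    simp only [Nat.cast_one, Real.logb_one, zero_div]
    positivity
  · have hb := (p n).card_bound (hp n).2.1 (hp n).2.2 hC (t := n * (C + γ)) (by positivity) h2
    rw [mul_div_mul_left _ _ hn'.ne'] at hb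
    have hK : (0 : ℝ) < Nat.card (p n).Msg := by exact_mod_cast hKpos
    have hlt := hn.le.trans hb
    rw [le_div_iff₀ hK] at hlt
    have hle : (Nat.card (p n).Msg : ℝ) ≤ 2 / κ * (2 : ℝ) ^ (n * (C + γ)) := by
      rw [div_mul_eq_mul_div, le_div_iff₀ hκpos]
      linarith
    have hlog := Real.logb_le_logb_of_le one_lt_two hK hle
    rw [Real.logb_mul (by positivity) (by positivity), Real.logb_rpow two_pos (by norm_num)] at hlog
    rw [Protocol.rate, div_le_iff₀ hn', add_mul, div_mul_cancel₀ _ hn'.ne']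
    have := le_abs_self (Real.logb 2 (2 / κ))
    linarith

end Converse

/-- The maximal equivocation is attained. -/
theorem exists_isGreatest_equivocation {X Z : Type*} [Fintype X] [Nonempty X] [Fintype Z]
    (W : X → PMF Z) : ∃ C, IsGreatest (Set.range fun P : PMF X => equivocation W P) C := by
  classical
  -- The equivocation as a function of real weights: continuous because `Real.negMulLog` is, hence
  -- maximal somewhere on the compact simplex.
  set h : (X → ℝ) → ℝ := fun w =>
    (∑ c : X × Z, Real.negMulLog (w c.1 * (W c.1 c.2).toReal)
      - ∑ z, Real.negMulLog (∑ x, w x * (W x z).toReal)) / Real.log 2 with hh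
  have hcont : Continuous h := by
    have := Real.continuous_negMulLog
    fun_prop
  have heq : ∀ P : PMF X, equivocation W P = h fun x => (P x).toReal := by
    intro P
    rw [equivocation, jointLaw_map_snd, entropy, entropy]
    simp only [hh, sub_div, Finset.sum_div, ← Finset.sum_neg_distrib]
    congr 1
    · refine Finset.sum_congr rfl fun c _ => ?_
      rw [show jointLaw W P c = jointLaw W P (c.1, c.2) from rfl, jointLaw_toReal, Real.negMulLog,
        Real.logb]
      ring
    · refine Finset.sum_congr rfl fun z _ => ?_
      rw [bind_toReal, Real.negMulLog, Real.logb]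
      ring
  have hmem : ∀ P : PMF X, (fun x => (P x).toReal) ∈ stdSimplex ℝ X := fun P =>
    ⟨fun x => ENNReal.toReal_nonneg, sum_toReal_pmf P⟩
  obtain ⟨w, hw, hmax⟩ := (isCompact_stdSimplex ℝ X).exists_isMaxOn
    ⟨_, hmem (PMF.pure (Classical.arbitrary X))⟩ hcont.continuousOn
  refine ⟨h w, ⟨pmfOfReal w hw.1 hw.2, ?_⟩, ?_⟩
  · dsimp only
    rw [heq]
    simp_rw [pmfOfReal_toReal]
  · rintro _ ⟨P, rfl⟩
    dsimp only
    rw [heq]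
    exact hmax (hmem P)

end Commitment

end

theorem theorem1 {X Z : Type*} [Fintype X] [Nonempty X] [Fintype Z]
    (W : X → PMF Z) (hW : Commitment.NonRedundant W) :
    ∃ C : ℝ,
      IsGreatest (Set.range fun P : PMF X => Commitment.equivocation W P) C ∧
      ∀ B : ENNReal, Commitment.IsCommitmentCapacity W B C := by
  obtain ⟨C, hC⟩ := Commitment.exists_isGreatest_equivocation W
  refine ⟨C, hC, fun B => ?_⟩
  obtain ⟨⟨P, hP⟩, hmax⟩ := hC
  have hle : ∀ P, Commitment.equivocation W P ≤ C := fun P => hmax ⟨P, rfl⟩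
  have hC0 : 0 ≤ C := (Commitment.equivocation_nonneg W P).trans (hle P)
  refine ⟨fun R hR => hR.le_of_equivocation_le hC0 hle, fun b hb => ?_⟩
  refine le_of_forall_lt fun R hR => ?_
  obtain ⟨R', hRR', hR'C⟩ := exists_between hR
  -- Codes exist for nonnegative rates only; below zero it is enough that the rate `0` is
  -- achievable.
  rcases le_or_gt 0 R' with h0 | h0
  · exact hRR'.trans_le (hb (Commitment.achievable_of_lt_equivocation hW P h0
      (hR'C.trans_eq hP.symm) B))
  · exact (hRR'.trans h0).trans_le (hb (Commitment.achievable_zero W B))
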